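/- Let $\mathcal A:\mathbb R^{n_1\times n_2}\to\mathbb R^m$ be a linear map, $n=\max(n_1,n_2)$, and let $\mathcal A^*$ be its adjoint with respect to the inner product $\langle X,Y\rangle=\operatorname{trace}(X^*Y)$ on matrices and the Euclidean inner product on $\mathbb R^m$. Write $\|\cdot\|_F$, $\|\cdot\|$, $\|\cdot\|_*$ for the Frobenius norm, the operator norm (largest singular value) and the nuclear norm (sum of the singular values) of a matrix. For an integer $k\ge 1$ the isometry constant $\delta_k=\delta_k(\mathcal A)$ is the smallest $\delta$ such that $(1-\delta)\|X\|_F^2\le\|\mathcal A(X)\|_{\ell_2}^2\le(1+\delta)\|X\|_F^2$ for all $X\in\mathbb R^{n_1\times n_2}$ of rank at most $k$. Let $y=\mathcal A(M)+z$ with $M\in\mathbb R^{n_1\times n_2}$ and $z\in\mathbb R^m$. A matrix Dantzig selector solution $\hat M_{DS}$ with parameter $\lambda$ is any minimizer of $\|X\|_*$ subject to $\|\mathcal A^*(y-\mathcal A(X))\|\le\lambda$. A matrix Lasso solution $\hat M_L$ with parameter $\mu>0$ is any minimizer of $\tfrac12\|\mathcal A(X)-y\|_{\ell_2}^2+\mu\|X\|_*$.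 **Theorem.** There are functions $C_0,C_1,C_0'$ of one real variable and a numerical constant $c>0$ such that for all $n_1,n_2,m$, all $r\ge1$, all $\mathcal A$ as above, and all $M$ with $\operatorname{rank}(M)\le r$, the following hold. 1. If $\delta_{4r}<\sqrt2-1$ and $\|\mathcal A^*(z)\|\le\lambda$, then every $\hat M_{DS}$ with parameter $\lambda$ satisfies $\|\hat M_{DS}-M\|_F^2\le C_0(\delta_{4r})\,r\lambda^2$. 2. If $\delta_{4r}<(3\sqrt2-1)/17$, $\mu>0$ and $\|\mathcal A^*(z)\|\le\mu/2$, then every $\hat M_L$ with parameter $\mu$ satisfies $\|\hat M_L-M\|_F^2\le C_1(\delta_{4r})\,r\mu^2$. 3. Suppose that $z$ is a random vector with i.i.d. $\mathcal N(0,\sigma^2)$ entries, $\sigma\ge0$. If $\delta_{4r}<\sqrt2-1$, then on an event of probability at least $1-2e^{-cn}$ every $\hat M_{DS}$ with $\lambda=8\sqrt n\,\sigma$ satisfies $\|\hat M_{DS}-M\|_F^2\le C_0'(\delta_{4r})\,nr\sigma^2$. If $\delta_{4r}<(3\sqrt2-1)/17$ and $\sigma>0$, then on an event of probability at least $1-2e^{-cn}$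 every $\hat M_L$ with $\mu=16\sqrt n\,\sigma$ satisfies $\|\hat M_L-M\|_F^2\le C_0'(\delta_{4r})\,nr\sigma^2$. -/

import Mathlib

open MeasureTheory ProbabilityTheory
open scoped NNReal

noncomputable section

namespace LowRank

variable {n₁ n₂ m : ℕ}

/-- The Frobenius norm of a real matrix. -/
def frobNorm (X : Matrix (Fin n₁) (Fin n₂) ℝ) : ℝ :=
  √(∑ i, ∑ j, X i j ^ 2)

/-- The operator norm (top singular value) of a real matrix, acting between Euclidean spaces. -/
def opNorm (X : Matrix (Fin n₁) (Fin n₂) ℝ) : ℝ :=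
  ‖LinearMap.toContinuousLinearMap (Matrix.toEuclideanLin X)‖

/-- The nuclear norm of a real matrix: the sum of its singular values. (Mathlib's sequence of
singular values is indexed from zero and vanishes from the dimension of the domain on.) -/
def nuclearNorm (X : Matrix (Fin n₁) (Fin n₂) ℝ) : ℝ :=
  ∑ i ∈ Finset.range n₂, (Matrix.toEuclideanLin X).singularValues i

/-- The adjoint of a linear measurement map, for the inner product `trace (Aᵀ * X)` on matrices
(see `trace_adj_mul` and `adj_eq_sum`). -/
def adj (A : Matrix (Fin n₁) (Fin n₂) ℝ →ₗ[ℝ] EuclideanSpace ℝ (Fin m))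
    (q : EuclideanSpace ℝ (Fin m)) : Matrix (Fin n₁) (Fin n₂) ℝ :=
  Matrix.of fun j k => inner ℝ (A (Matrix.single j k 1)) q

theorem map_eq_sum (A : Matrix (Fin n₁) (Fin n₂) ℝ →ₗ[ℝ] EuclideanSpace ℝ (Fin m))
    (X : Matrix (Fin n₁) (Fin n₂) ℝ) :
    A X = ∑ i, ∑ j, X i j • A (Matrix.single i j 1) := by
  conv_lhs => rw [Matrix.matrix_eq_sum_single X]
  simp only [map_sum]
  refine Finset.sum_congr rfl fun i _ => Finset.sum_congr rfl fun j _ => ?_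
  rw [← map_smul, Matrix.smul_single, smul_eq_mul, mul_one]

/-- The adjoint identity `⟨A* q, X⟩ = ⟨q, A X⟩`. -/
theorem trace_adj_mul (A : Matrix (Fin n₁) (Fin n₂) ℝ →ₗ[ℝ] EuclideanSpace ℝ (Fin m))
    (q : EuclideanSpace ℝ (Fin m)) (X : Matrix (Fin n₁) (Fin n₂) ℝ) :
    ((adj A q).transpose * X).trace = inner ℝ q (A X) := by
  rw [map_eq_sum A X]
  simp only [Matrix.trace, Matrix.diag_apply, Matrix.mul_apply, Matrix.transpose_apply, adj,
    Matrix.of_apply, inner_sum, inner_smul_right]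
  rw [Finset.sum_comm]
  refine Finset.sum_congr rfl fun i _ => Finset.sum_congr rfl fun j _ => ?_
  rw [real_inner_comm, mul_comm]

/-- If the measurements are `[A X]ᵢ = ⟨Bᵢ, X⟩`, then `A* q = ∑ᵢ qᵢ Bᵢ`. -/
theorem adj_eq_sum (A : Matrix (Fin n₁) (Fin n₂) ℝ →ₗ[ℝ] EuclideanSpace ℝ (Fin m))
    (B : Fin m → Matrix (Fin n₁) (Fin n₂) ℝ)
    (hB : ∀ X i, A X i = ((B i).transpose * X).trace) (q : EuclideanSpace ℝ (Fin m)) :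
    adj A q = ∑ i, q i • B i := by
  ext j k
  simp [adj, PiLp.inner_apply, hB, Matrix.sum_apply, Matrix.trace_mul_single]

/-- The two-sided inequality of the restricted isometry property at rank `r`. -/
def RIPBound (A : Matrix (Fin n₁) (Fin n₂) ℝ →ₗ[ℝ] EuclideanSpace ℝ (Fin m))
    (r : ℕ) (δ : ℝ) : Prop :=
  ∀ X : Matrix (Fin n₁) (Fin n₂) ℝ, X.rank ≤ r →
    (1 - δ) * frobNorm X ^ 2 ≤ ‖A X‖ ^ 2 ∧ ‖A X‖ ^ 2 ≤ (1 + δ) * frobNorm X ^ 2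

/-- The isometry constant `δ_r`: the smallest `δ` with `RIPBound A r δ`
(see `isLeast_isometryConst`). -/
def isometryConst (A : Matrix (Fin n₁) (Fin n₂) ℝ →ₗ[ℝ] EuclideanSpace ℝ (Fin m))
    (r : ℕ) : ℝ :=
  sInf {δ : ℝ | RIPBound A r δ}

theorem frobNorm_sq (X : Matrix (Fin n₁) (Fin n₂) ℝ) :
    frobNorm X ^ 2 = ∑ i, ∑ j, X i j ^ 2 :=
  Real.sq_sqrt (Finset.sum_nonneg fun _ _ => Finset.sum_nonneg fun _ _ => sq_nonneg _)

/-- The infimum defining the isometry constant is attained. -/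
theorem isLeast_isometryConst (A : Matrix (Fin n₁) (Fin n₂) ℝ →ₗ[ℝ] EuclideanSpace ℝ (Fin m))
    {r : ℕ} (hr : 1 ≤ r) (h₁ : 1 ≤ n₁) (h₂ : 1 ≤ n₂) :
    IsLeast {δ : ℝ | RIPBound A r δ} (isometryConst A r) := by
  have hbdd : BddBelow {δ : ℝ | RIPBound A r δ} := by
    refine ⟨0, fun δ hδ => ?_⟩
    have h := hδ (Matrix.single ⟨0, h₁⟩ ⟨0, h₂⟩ 1) (by
      rw [Matrix.single_eq_single_vecMulVec_single]
      exact (Matrix.rank_vecMulVec_le _ _).trans hr)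
    have hF : frobNorm (Matrix.single (⟨0, h₁⟩ : Fin n₁) (⟨0, h₂⟩ : Fin n₂) (1 : ℝ)) ^ 2 = 1 := by
      rw [frobNorm_sq]
      simp [Matrix.single_apply, ite_and]
    rw [hF] at h
    linarith [h.1, h.2]
  have hne : {δ : ℝ | RIPBound A r δ}.Nonempty := by
    set K : ℝ := ∑ p : Fin n₁ × Fin n₂, ‖A (Matrix.single p.1 p.2 1)‖ ^ 2 with hK
    have hK0 : 0 ≤ K := Finset.sum_nonneg fun _ _ => sq_nonneg _
    refine ⟨1 + K, fun X _ => ?_⟩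
    have hF0 : 0 ≤ frobNorm X ^ 2 := sq_nonneg _
    have hle : ‖A X‖ ≤ ∑ p : Fin n₁ × Fin n₂, |X p.1 p.2| * ‖A (Matrix.single p.1 p.2 1)‖ := by
      rw [map_eq_sum A X, ← Fintype.sum_prod_type'
        (f := fun i j => X i j • A (Matrix.single i j 1))]
      refine (norm_sum_le _ _).trans (Finset.sum_le_sum fun p _ => ?_)
      rw [norm_smul, Real.norm_eq_abs]
    have hsq : ‖A X‖ ^ 2 ≤ frobNorm X ^ 2 * K := by
      refine (pow_le_pow_left₀ (norm_nonneg _) hle 2).trans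
        ((Finset.sum_mul_sq_le_sq_mul_sq _ _ _).trans (le_of_eq ?_))
      rw [frobNorm_sq, ← Fintype.sum_prod_type' (f := fun i j => X i j ^ 2)]
      simp only [sq_abs, hK]
    exact ⟨by nlinarith [sq_nonneg ‖A X‖], by nlinarith⟩
  have hcl : IsClosed {δ : ℝ | RIPBound A r δ} := by
    have : {δ : ℝ | RIPBound A r δ} = ⋂ X : Matrix (Fin n₁) (Fin n₂) ℝ, ⋂ _ : X.rank ≤ r,
        ({δ : ℝ | (1 - δ) * frobNorm X ^ 2 ≤ ‖A X‖ ^ 2} ∩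
          {δ : ℝ | ‖A X‖ ^ 2 ≤ (1 + δ) * frobNorm X ^ 2}) := by
      ext δ
      simp [RIPBound]
    rw [this]
    refine isClosed_iInter fun X => isClosed_iInter fun _ => IsClosed.inter ?_ ?_
    · exact isClosed_le (by fun_prop) (by fun_prop)
    · exact isClosed_le (by fun_prop) (by fun_prop)
  exact ⟨hcl.csInf_mem hne hbdd, fun δ hδ => csInf_le hbdd hδ⟩

/-- `X` solves the matrix Dantzig selector: it minimizes the nuclear norm among the matrices `W`
with `‖A* (y - A W)‖ ≤ lam`. -/
def IsDantzigSolution (A : Matrix (Fin n₁) (Fin n₂) ℝ →ₗ[ℝ] EuclideanSpace ℝ (Fin m))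
    (y : EuclideanSpace ℝ (Fin m)) (lam : ℝ) (X : Matrix (Fin n₁) (Fin n₂) ℝ) : Prop :=
  opNorm (adj A (y - A X)) ≤ lam ∧
    ∀ W : Matrix (Fin n₁) (Fin n₂) ℝ, opNorm (adj A (y - A W)) ≤ lam →
      nuclearNorm X ≤ nuclearNorm W

/-- `X` solves the matrix Lasso: it minimizes `½ ‖A W - y‖² + μ ‖W‖_*` over all matrices `W`. -/
def IsLassoSolution (A : Matrix (Fin n₁) (Fin n₂) ℝ →ₗ[ℝ] EuclideanSpace ℝ (Fin m))
    (y : EuclideanSpace ℝ (Fin m)) (μ : ℝ) (X : Matrix (Fin n₁) (Fin n₂) ℝ) : Prop :=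
  ∀ W : Matrix (Fin n₁) (Fin n₂) ℝ,
    1 / 2 * ‖A X - y‖ ^ 2 + μ * nuclearNorm X ≤ 1 / 2 * ‖A W - y‖ ^ 2 + μ * nuclearNorm W

/-- The random vector `z` has i.i.d. `N(0, σ²)` entries under `P`. -/
structure IsGaussianNoise {Ω : Type*} [MeasurableSpace Ω] (P : Measure Ω) (σ : ℝ≥0)
    (z : Ω → EuclideanSpace ℝ (Fin m)) : Prop where
  law : ∀ i, HasLaw (fun ω => z ω i) (gaussianReal 0 (σ ^ 2)) P
  indep : iIndepFun (fun i ω => z ω i) P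

end LowRank

end

noncomputable section

namespace LowRank

open Matrix

variable {n₁ n₂ m : ℕ}

/-! Put `H = Mhat - M`. Optimality gives two facts about `H`. First, `‖A* A H‖ ≤ τ`, with `τ = 2λ`
for the Dantzig selector and `τ = 3μ/2` for the Lasso, whose first-order condition is `‖A*(y - A
Mhat)‖ ≤ μ`. Second, a cone condition: split `H = H₀ + Hc`, where `Hc` is orthogonal to the row and
column spaces of `M` and `rank H₀ ≤ 2r` (`exists_orthogonal_decomposition`); then `‖Hc‖_* ≤ κ
‖H₀‖_*`, with `κ = 1` and `κ = 3` respectively.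

These suffice under restricted isometry (`frobNorm_le_of_cone`). Cut the decreasing singular values
of `Hc` into blocks of length `2r`, and let `X` be `H₀` plus the first block, so `rank X ≤ 4r`. The
Frobenius norms of the later blocks sum to at most `‖Hc‖_* / √(2r) ≤ κ ‖H₀‖_F`
(`le_sum_of_block_le`), and `A` nearly preserves their orthogonality to `H₀` and to the first block
(`abs_inner_map_le_of_frobInner_eq_zero`). Expanding `⟨A H, A X⟩` then gives `(1 - δ)‖X‖² ≤ 2τ√r ‖X‖
+ √2 κ δ ‖X‖²`, and `‖H‖ ≤ (1 + κ)‖X‖`. The requirement `(1 + κ√2)δ < 1` reads `δ < √2 - 1` for `κ =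
1` and `δ < (3√2 - 1)/17` for `κ = 3`.

For Gaussian noise it remains to bound `‖A* z‖` (`IsGaussianNoise.exists_event`). On 1/4-nets of the
two unit spheres this is a union bound over at most `81 ^ n` variables `⟨z, A(u vᵀ)⟩`, whose
variances are controlled by restricted isometry at rank one. -/

/-- The trace inner product of real matrices. -/
def frobInner (X Y : Matrix (Fin n₁) (Fin n₂) ℝ) : ℝ :=
  (Xᵀ * Y).trace

/-! ### Frobenius geometry and operator-norm bounds. -/

theorem frobInner_self (X : Matrix (Fin n₁) (Fin n₂) ℝ) : frobInner X X = frobNorm X ^ 2 := by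
  rw [frobNorm_sq, Finset.sum_comm]
  simp [frobInner, trace, mul_apply, sq]

theorem frobInner_comm (X Y : Matrix (Fin n₁) (Fin n₂) ℝ) : frobInner X Y = frobInner Y X := by
  rw [frobInner, ← trace_transpose, transpose_mul, transpose_transpose, frobInner]

theorem frobInner_add_right (X Y Z : Matrix (Fin n₁) (Fin n₂) ℝ) :
    frobInner X (Y + Z) = frobInner X Y + frobInner X Z := by
  simp [frobInner, Matrix.mul_add]

theorem frobInner_smul_right (X Y : Matrix (Fin n₁) (Fin n₂) ℝ) (c : ℝ) :
    frobInner X (c • Y) = c * frobInner X Y := by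
  simp [frobInner]

theorem frobInner_add_left (X Y Z : Matrix (Fin n₁) (Fin n₂) ℝ) :
    frobInner (X + Y) Z = frobInner X Z + frobInner Y Z := by
  simp [frobInner, Matrix.add_mul]

theorem frobInner_smul_left (X Y : Matrix (Fin n₁) (Fin n₂) ℝ) (c : ℝ) :
    frobInner (c • X) Y = c * frobInner X Y := by
  simp [frobInner]

theorem frobInner_vecMulVec (Y : Matrix (Fin n₁) (Fin n₂) ℝ) (u : Fin n₁ → ℝ) (v : Fin n₂ → ℝ) :
    frobInner Y (vecMulVec u v) = u ⬝ᵥ Y *ᵥ v := by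
  rw [frobInner, mul_vecMulVec, trace_vecMulVec, mulVec_transpose, dotProduct_mulVec]

theorem frobInner_adj (A : Matrix (Fin n₁) (Fin n₂) ℝ →ₗ[ℝ] EuclideanSpace ℝ (Fin m))
    (q : EuclideanSpace ℝ (Fin m)) (X : Matrix (Fin n₁) (Fin n₂) ℝ) :
    frobInner (adj A q) X = inner ℝ q (A X) :=
  trace_adj_mul A q X

theorem frobNorm_nonneg (X : Matrix (Fin n₁) (Fin n₂) ℝ) : 0 ≤ frobNorm X :=
  Real.sqrt_nonneg _

theorem frobNorm_add_sq (X Y : Matrix (Fin n₁) (Fin n₂) ℝ) :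
    frobNorm (X + Y) ^ 2 = frobNorm X ^ 2 + 2 * frobInner X Y + frobNorm Y ^ 2 := by
  simp only [← frobInner_self, frobInner_add_right, frobInner_add_left, frobInner_comm Y X]
  ring

theorem frobNorm_smul_sq (c : ℝ) (X : Matrix (Fin n₁) (Fin n₂) ℝ) :
    frobNorm (c • X) ^ 2 = c ^ 2 * frobNorm X ^ 2 := by
  simp only [← frobInner_self, frobInner_smul_right, frobInner_smul_left]
  ring

theorem frobInner_le_mul (X Y : Matrix (Fin n₁) (Fin n₂) ℝ) :
    frobInner X Y ≤ frobNorm X * frobNorm Y := by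
  have h : ∀ t : ℝ, 0 ≤ (frobNorm Y ^ 2) * (t * t) + (2 * frobInner X Y) * t + frobNorm X ^ 2 := by
    intro t
    have := sq_nonneg (frobNorm (X + t • Y))
    rw [frobNorm_add_sq, frobNorm_smul_sq, frobInner_smul_right] at this
    linarith
  have hd := discrim_le_zero h
  rw [discrim] at hd
  refine (le_abs_self _).trans (abs_le_of_sq_le_sq (by nlinarith) ?_)
  exact mul_nonneg (frobNorm_nonneg _) (frobNorm_nonneg _)

theorem frobNorm_add_le (X Y : Matrix (Fin n₁) (Fin n₂) ℝ) :
    frobNorm (X + Y) ≤ frobNorm X + frobNorm Y := by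
  refine le_of_sq_le_sq ?_ (add_nonneg (frobNorm_nonneg _) (frobNorm_nonneg _))
  rw [frobNorm_add_sq]
  linarith [frobInner_le_mul X Y]

/-- The operator norm bounds the bilinear form of a matrix. -/
theorem dotProduct_mulVec_le_opNorm (Y : Matrix (Fin n₁) (Fin n₂) ℝ) (u : EuclideanSpace ℝ (Fin n₁))
    (v : EuclideanSpace ℝ (Fin n₂)) :
    u.ofLp ⬝ᵥ Y *ᵥ v.ofLp ≤ opNorm Y * ‖u‖ * ‖v‖ := by
  have h := (LinearMap.toContinuousLinearMap (toEuclideanLin Y)).le_opNorm v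
  have h2 := real_inner_le_norm (toEuclideanLin Y v) u
  rw [EuclideanSpace.inner_eq_star_dotProduct] at h2
  simp only [star_trivial, ofLp_toLpLin, toLin'_apply] at h2
  refine h2.trans ?_
  rw [mul_comm (opNorm Y), mul_assoc, mul_comm]
  exact mul_le_mul_of_nonneg_left h (norm_nonneg _)

theorem opNorm_le_of_unit {Y : Matrix (Fin n₁) (Fin n₂) ℝ} {c : ℝ} (hc : 0 ≤ c)
    (h : ∀ (u : EuclideanSpace ℝ (Fin n₁)) (v : EuclideanSpace ℝ (Fin n₂)), ‖u‖ = 1 → ‖v‖ = 1 →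
      u.ofLp ⬝ᵥ Y *ᵥ v.ofLp ≤ c) : opNorm Y ≤ c := by
  refine ContinuousLinearMap.opNorm_le_of_unit_norm hc fun v hv => ?_
  set w : EuclideanSpace ℝ (Fin n₁) := toEuclideanLin Y v with hw
  change ‖w‖ ≤ c
  rcases eq_or_ne w 0 with h0 | h0
  · simpa [h0] using hc
  · have h1 := h (‖w‖⁻¹ • w) v (by simp [norm_smul, h0]) hv
    have h2 : w.ofLp ⬝ᵥ Y *ᵥ v.ofLp = ‖w‖ ^ 2 := by
      rw [← real_inner_self_eq_norm_sq, EuclideanSpace.inner_eq_star_dotProduct]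
      simp [hw]
    rw [WithLp.ofLp_smul, smul_dotProduct, h2, smul_eq_mul, sq, inv_mul_cancel_left₀] at h1
    · exact h1
    · simpa using h0

theorem opNorm_nonneg (Y : Matrix (Fin n₁) (Fin n₂) ℝ) : 0 ≤ opNorm Y :=
  norm_nonneg _

theorem opNorm_neg (X : Matrix (Fin n₁) (Fin n₂) ℝ) : opNorm (-X) = opNorm X := by
  rw [opNorm, opNorm, map_neg, map_neg, norm_neg]

/-! ### Singular value decomposition and duality for the nuclear norm. -/

/-- A compact singular value decomposition. -/
theorem exists_svd (X : Matrix (Fin n₁) (Fin n₂) ℝ) :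
    ∃ (U : Matrix (Fin n₁) (Fin X.rank) ℝ) (V : Matrix (Fin n₂) (Fin X.rank) ℝ)
      (s : Fin X.rank → ℝ), Uᵀ * U = 1 ∧ Vᵀ * V = 1 ∧ (∀ i, 0 < s i) ∧ Antitone s ∧
      X = U * diagonal s * Vᵀ ∧ nuclearNorm X = ∑ i, s i := by
  set T := toEuclideanLin X with hT
  have hrank : X.rank = Module.finrank ℝ T.range := by
    rw [hT, toEuclideanLin, toLpLin_eq_toLin]
    exact rank_eq_finrank_range_toLin X _ _
  have hle : X.rank ≤ n₂ := by simpa using rank_le_width X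
  have hn : Module.finrank ℝ (EuclideanSpace ℝ (Fin n₂)) = n₂ := finrank_euclideanSpace_fin
  set b := T.isSymmetric_adjoint_comp_self.eigenvectorBasis hn with hb
  set s : ℕ → ℝ := fun i => T.singularValues i with hs
  have hpos : ∀ i : Fin X.rank, 0 < s i := fun i =>
    T.singularValues_pos_iff_lt_finrank_range.2 (hrank ▸ i.2)
  have hzero : ∀ i : ℕ, X.rank ≤ i → s i = 0 := fun i hi =>
    T.singularValues_eq_zero_iff_le_finrank_range.2 (hrank ▸ hi)
  have hin : ∀ i j, inner ℝ (T (b i)) (T (b j)) = s i ^ 2 * if i = j then 1 else 0 := by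
    intro i j
    rw [← LinearMap.adjoint_inner_left, ← LinearMap.comp_apply,
      T.isSymmetric_adjoint_comp_self.apply_eigenvectorBasis, inner_smul_left,
      orthonormal_iff_ite.1 b.orthonormal, hs, T.sq_singularValues_fin hn]
    simp
  have hTz : ∀ i : Fin n₂, X.rank ≤ i → T (b i) = 0 := by
    intro i hi
    have := hin i i
    rw [hzero i hi] at this
    simpa using this
  set e : Fin X.rank → Fin n₂ := Fin.castLE hle with he
  have einj : Function.Injective e := Fin.castLE_injective hle
  have erange : ∀ i ∉ Set.range e, X.rank ≤ i := by
    intro i hi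
    by_contra! h
    exact hi ⟨⟨i, h⟩, rfl⟩
  -- The right vectors are eigenvectors `b i` of `T* T`; the left ones are `T (b i) / s i`,
  -- orthonormal by `hin`. Indices from the rank on contribute nothing, as `T (b i) = 0` there.
  refine ⟨of fun a i => (s i)⁻¹ * (T (b (e i))).ofLp a, of fun a i => (b (e i)).ofLp a, fun i => s i,
    ?_, ?_, hpos, fun i j hij => T.singularValues_antitone hij, ?_, ?_⟩
  · ext i j
    have h := hin (e i) (e j)
    rw [EuclideanSpace.inner_eq_star_dotProduct] at h
    simp only [einj.eq_iff, star_trivial, dotProduct] at h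
    have : ((s i)⁻¹ * (s j)⁻¹) * ∑ a, (T (b (e j))).ofLp a * (T (b (e i))).ofLp a =
        (1 : Matrix (Fin X.rank) (Fin X.rank) ℝ) i j := by
      rw [h, one_apply]
      have hi := (hpos i).ne'
      split_ifs with hij
      · subst hij
        simp only [he, Fin.val_castLE]
        field_simp
      · simp
    rw [← this, mul_apply, Finset.mul_sum]
    refine Finset.sum_congr rfl fun a _ => ?_
    simp only [transpose_apply, of_apply]
    ring
  · ext i j
    have h := orthonormal_iff_ite.1 b.orthonormal (e i) (e j)
    rw [EuclideanSpace.inner_eq_star_dotProduct] at h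
    simp only [einj.eq_iff, star_trivial, dotProduct] at h
    rw [one_apply, ← h, mul_apply]
    exact Finset.sum_congr rfl fun a _ => mul_comm _ _
  · ext a c
    have h1 : X a c = (T (EuclideanSpace.single c 1)).ofLp a := by
      simp [hT]
    have h2 : T (EuclideanSpace.single c 1) = ∑ i, (b i).ofLp c • T (b i) := by
      conv_lhs => rw [← b.sum_repr' (EuclideanSpace.single c 1)]
      simp [EuclideanSpace.inner_single_right]
    rw [h1, h2, WithLp.ofLp_sum, Finset.sum_apply, mul_apply]
    symm
    refine Fintype.sum_of_injective e einj _ _ (fun i hi => ?_) fun i => ?_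
    · simp [hTz i (erange i hi)]
    · have hi := (hpos i).ne'
      simp only [mul_diagonal, of_apply, transpose_apply, WithLp.ofLp_smul, Pi.smul_apply,
        smul_eq_mul]
      field_simp
  · rw [nuclearNorm, Finset.sum_range]
    symm
    exact Fintype.sum_of_injective e einj _ _ (fun i hi => hzero i (erange i hi)) fun i => rfl

section Orthonormal

variable {ι : Type*} [Fintype ι] [DecidableEq ι]

omit [Fintype ι] in
theorem norm_col_eq_one {k : ℕ} {U : Matrix (Fin k) ι ℝ} (hU : Uᵀ * U = 1) (i : ι) :
    ‖WithLp.toLp 2 (U.col i)‖ = 1 := by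
  have h := congrFun (congrFun hU i) i
  rw [← sq_eq_sq₀ (norm_nonneg _) zero_le_one, EuclideanSpace.norm_sq_eq]
  simpa [mul_apply, sq] using h

theorem frobInner_factor (Y : Matrix (Fin n₁) (Fin n₂) ℝ) (U : Matrix (Fin n₁) ι ℝ)
    (V : Matrix (Fin n₂) ι ℝ) (s : ι → ℝ) :
    frobInner Y (U * diagonal s * Vᵀ) = ∑ i, s i * (U.col i ⬝ᵥ Y *ᵥ V.col i) := by
  have h : U * diagonal s * Vᵀ = ∑ i, s i • vecMulVec (U.col i) (V.col i) := by
    ext a c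
    rw [mul_apply]
    simp only [mul_diagonal, Matrix.sum_apply, Matrix.smul_apply, vecMulVec_apply, col_apply,
      transpose_apply, smul_eq_mul]
    exact Finset.sum_congr rfl fun i _ => by ring
  rw [h, frobInner, Matrix.mul_sum, trace_sum]
  refine Finset.sum_congr rfl fun i _ => ?_
  rw [← frobInner_vecMulVec, ← frobInner_smul_right, frobInner]

theorem frobInner_factor_le (Y : Matrix (Fin n₁) (Fin n₂) ℝ) {U : Matrix (Fin n₁) ι ℝ}
    {V : Matrix (Fin n₂) ι ℝ} {s : ι → ℝ} (hU : Uᵀ * U = 1) (hV : Vᵀ * V = 1)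
    (hs : ∀ i, 0 ≤ s i) :
    frobInner Y (U * diagonal s * Vᵀ) ≤ opNorm Y * ∑ i, s i := by
  rw [frobInner_factor, Finset.mul_sum]
  refine Finset.sum_le_sum fun i _ => ?_
  rw [mul_comm (opNorm Y)]
  refine mul_le_mul_of_nonneg_left ?_ (hs i)
  have h := dotProduct_mulVec_le_opNorm Y (WithLp.toLp 2 (U.col i)) (WithLp.toLp 2 (V.col i))
  rwa [norm_col_eq_one hU, norm_col_eq_one hV, mul_one, mul_one] at h

theorem frobInner_factor_factor {U : Matrix (Fin n₁) ι ℝ}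
    {V : Matrix (Fin n₂) ι ℝ} (hU : Uᵀ * U = 1) (hV : Vᵀ * V = 1) (s t : ι → ℝ) :
    frobInner (U * diagonal s * Vᵀ) (U * diagonal t * Vᵀ) = ∑ i, s i * t i := by
  have h : (U * diagonal s * Vᵀ)ᵀ * (U * diagonal t * Vᵀ) =
      V * (diagonal s * (Uᵀ * U) * diagonal t * Vᵀ) := by
    simp only [transpose_mul, transpose_transpose, diagonal_transpose, Matrix.mul_assoc]
  rw [frobInner, h, trace_mul_comm, hU, Matrix.mul_one, Matrix.mul_assoc, hV, Matrix.mul_one,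
    diagonal_mul_diagonal, trace_diagonal]

theorem frobNorm_factor_sq {U : Matrix (Fin n₁) ι ℝ}
    {V : Matrix (Fin n₂) ι ℝ} (hU : Uᵀ * U = 1) (hV : Vᵀ * V = 1) (s : ι → ℝ) :
    frobNorm (U * diagonal s * Vᵀ) ^ 2 = ∑ i, s i ^ 2 := by
  rw [← frobInner_self, frobInner_factor_factor hU hV]
  simp [sq]

/-- Bessel's inequality, from expanding `0 ≤ ‖u - U Uᵀ u‖²`. -/
theorem norm_vecMul_le {k : ℕ} {U : Matrix (Fin k) ι ℝ} (hU : Uᵀ * U = 1)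
    (u : EuclideanSpace ℝ (Fin k)) : ‖WithLp.toLp 2 (u.ofLp ᵥ* U)‖ ≤ ‖u‖ := by
  set w := u.ofLp ᵥ* U with hw
  have h0 : 0 ≤ (u.ofLp - U *ᵥ w) ⬝ᵥ (u.ofLp - U *ᵥ w) := by
    exact Finset.sum_nonneg fun i _ => mul_self_nonneg _
  have h1 : (U *ᵥ w) ⬝ᵥ (U *ᵥ w) = w ⬝ᵥ w := by
    rw [dotProduct_mulVec, ← mulVec_transpose, mulVec_mulVec, hU, one_mulVec]
  have h2 : u.ofLp ⬝ᵥ (U *ᵥ w) = w ⬝ᵥ w := by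
    rw [dotProduct_mulVec]
  have h3 : w ⬝ᵥ w ≤ u.ofLp ⬝ᵥ u.ofLp := by
    rw [dotProduct_sub, sub_dotProduct, sub_dotProduct, h1, dotProduct_comm (U *ᵥ w), h2] at h0
    linarith
  refine le_of_sq_le_sq ?_ (norm_nonneg _)
  rw [EuclideanSpace.norm_sq_eq, EuclideanSpace.norm_sq_eq]
  simpa [dotProduct, sq] using h3

theorem opNorm_mul_transpose_le_one {U : Matrix (Fin n₁) ι ℝ}
    {V : Matrix (Fin n₂) ι ℝ} (hU : Uᵀ * U = 1) (hV : Vᵀ * V = 1) : opNorm (U * Vᵀ) ≤ 1 := by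
  refine opNorm_le_of_unit zero_le_one fun u v hu hv => ?_
  have h := real_inner_le_norm (WithLp.toLp 2 (v.ofLp ᵥ* V)) (WithLp.toLp 2 (u.ofLp ᵥ* U))
  rw [EuclideanSpace.inner_eq_star_dotProduct] at h
  have h1 := norm_vecMul_le hU u
  have h2 := norm_vecMul_le hV v
  rw [hu] at h1
  rw [hv] at h2
  rw [← mulVec_mulVec, dotProduct_mulVec, mulVec_transpose]
  exact h.trans (mul_le_one₀ h2 (norm_nonneg _) h1)

theorem frobInner_le_opNorm_mul_nuclearNorm (Y X : Matrix (Fin n₁) (Fin n₂) ℝ) :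
    frobInner Y X ≤ opNorm Y * nuclearNorm X := by
  obtain ⟨U, V, s, hU, hV, hs, -, hX, hn⟩ := exists_svd X
  rw [hn]
  conv_lhs => rw [hX]
  exact frobInner_factor_le Y hU hV fun i => (hs i).le

theorem nuclearNorm_nonneg (X : Matrix (Fin n₁) (Fin n₂) ℝ) : 0 ≤ nuclearNorm X :=
  Finset.sum_nonneg fun _ _ => LinearMap.singularValues_nonneg _ _

/-- Pairing with `U Vᵀ`, of operator norm at most one, returns the sum. With
`nuclearNorm_factor_le`, a factorization with nonnegative `s` computes the nuclear norm without
sorting `s` or matching it with the singular values. -/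
theorem sum_le_nuclearNorm_factor {U : Matrix (Fin n₁) ι ℝ}
    {V : Matrix (Fin n₂) ι ℝ} (hU : Uᵀ * U = 1) (hV : Vᵀ * V = 1) (s : ι → ℝ) :
    ∑ i, s i ≤ nuclearNorm (U * diagonal s * Vᵀ) := by
  have h := frobInner_le_opNorm_mul_nuclearNorm (U * Vᵀ) (U * diagonal s * Vᵀ)
  have h1 := frobInner_factor_factor hU hV (fun _ => 1) s
  rw [diagonal_one, Matrix.mul_one] at h1
  rw [h1] at h
  simp only [one_mul] at h
  exact h.trans (mul_le_of_le_one_left (nuclearNorm_nonneg _) (opNorm_mul_transpose_le_one hU hV))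

/-- Pair the matrix with the certificate `U' V'ᵀ` from its own singular value decomposition. -/
theorem nuclearNorm_factor_le {U : Matrix (Fin n₁) ι ℝ}
    {V : Matrix (Fin n₂) ι ℝ} (hU : Uᵀ * U = 1) (hV : Vᵀ * V = 1) {s : ι → ℝ}
    (hs : ∀ i, 0 ≤ s i) : nuclearNorm (U * diagonal s * Vᵀ) ≤ ∑ i, s i := by
  obtain ⟨U', V', s', hU', hV', -, -, hX, hn⟩ := exists_svd (U * diagonal s * Vᵀ)
  have h1 := frobInner_factor_factor hU' hV' (fun _ => 1) s'
  rw [diagonal_one, Matrix.mul_one, ← hX] at h1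
  simp only [one_mul] at h1
  rw [hn, ← h1]
  refine (frobInner_factor_le _ hU hV hs).trans ?_
  exact mul_le_of_le_one_left (Finset.sum_nonneg fun i _ => hs i)
    (opNorm_mul_transpose_le_one hU' hV')

end Orthonormal

theorem nuclearNorm_dual (X : Matrix (Fin n₁) (Fin n₂) ℝ) :
    ∃ Y : Matrix (Fin n₁) (Fin n₂) ℝ, opNorm Y ≤ 1 ∧ nuclearNorm X = frobInner Y X := by
  obtain ⟨U, V, s, hU, hV, -, -, hX, hn⟩ := exists_svd X
  refine ⟨U * Vᵀ, opNorm_mul_transpose_le_one hU hV, ?_⟩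
  have h1 := frobInner_factor_factor hU hV (fun _ => 1) s
  rw [diagonal_one, Matrix.mul_one, ← hX] at h1
  simp [h1, hn]

theorem nuclearNorm_add_le (X Y : Matrix (Fin n₁) (Fin n₂) ℝ) :
    nuclearNorm (X + Y) ≤ nuclearNorm X + nuclearNorm Y := by
  obtain ⟨Z, hZ, h⟩ := nuclearNorm_dual (X + Y)
  rw [h, frobInner_add_right]
  refine add_le_add ?_ ?_
  · exact (frobInner_le_opNorm_mul_nuclearNorm _ _).trans
      (mul_le_of_le_one_left (nuclearNorm_nonneg _) hZ)
  · exact (frobInner_le_opNorm_mul_nuclearNorm _ _).trans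
      (mul_le_of_le_one_left (nuclearNorm_nonneg _) hZ)

theorem nuclearNorm_neg_le (X : Matrix (Fin n₁) (Fin n₂) ℝ) :
    nuclearNorm (-X) ≤ nuclearNorm X := by
  obtain ⟨Z, hZ, h⟩ := nuclearNorm_dual (-X)
  have h2 := frobInner_le_opNorm_mul_nuclearNorm (-Z) X
  rw [opNorm_neg] at h2
  have h4 : frobInner Z (-X) = frobInner (-Z) X := by
    simp [frobInner]
  rw [h, h4]
  exact h2.trans (mul_le_of_le_one_left (nuclearNorm_nonneg _) hZ)

theorem nuclearNorm_le_sqrt_rank_mul_frobNorm (X : Matrix (Fin n₁) (Fin n₂) ℝ) {k : ℕ}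
    (hk : X.rank ≤ k) : nuclearNorm X ≤ √k * frobNorm X := by
  obtain ⟨U, V, s, hU, hV, -, -, hX, hn⟩ := exists_svd X
  have h2 := frobNorm_factor_sq hU hV s
  rw [← hX] at h2
  refine le_of_sq_le_sq ?_ (mul_nonneg (Real.sqrt_nonneg _) (frobNorm_nonneg _))
  rw [mul_pow, Real.sq_sqrt (Nat.cast_nonneg _), h2, hn]
  refine sq_sum_le_card_mul_sum_sq.trans ?_
  rw [Finset.card_univ, Fintype.card_fin]
  exact mul_le_mul_of_nonneg_right (by exact_mod_cast hk)
    (Finset.sum_nonneg fun i _ => sq_nonneg _)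

theorem nuclearNorm_vecMulVec_le {u : EuclideanSpace ℝ (Fin n₁)} {v : EuclideanSpace ℝ (Fin n₂)}
    (hu : ‖u‖ = 1) (hv : ‖v‖ = 1) : nuclearNorm (vecMulVec u.ofLp v.ofLp) ≤ 1 := by
  obtain ⟨Z, hZ, h⟩ := nuclearNorm_dual (vecMulVec u.ofLp v.ofLp)
  rw [h, frobInner_vecMulVec]
  have := dotProduct_mulVec_le_opNorm Z u v
  rw [hu, hv, mul_one, mul_one] at this
  exact this.trans hZ

theorem frobNorm_vecMulVec_sq (u : EuclideanSpace ℝ (Fin n₁)) (v : EuclideanSpace ℝ (Fin n₂)) :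
    frobNorm (vecMulVec u.ofLp v.ofLp) ^ 2 = ‖u‖ ^ 2 * ‖v‖ ^ 2 := by
  rw [frobNorm_sq, EuclideanSpace.norm_sq_eq, EuclideanSpace.norm_sq_eq, Finset.sum_mul_sum]
  simp [vecMulVec_apply, mul_pow]

/-! ### Near-orthogonality under restricted isometry, and blocks of singular values. -/

theorem rank_add_le (X Y : Matrix (Fin n₁) (Fin n₂) ℝ) : (X + Y).rank ≤ X.rank + Y.rank := by
  rw [Matrix.rank, Matrix.rank, Matrix.rank, mulVecLin_add]
  exact (Submodule.finrank_mono (LinearMap.range_add_le _ _)).trans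
    (Submodule.finrank_add_le_finrank_add_finrank _ _)

/-- Polarization: the upper bound at `X + tY` minus the lower bound at `X - tY` gives `2t⟨A X, A Y⟩
≤ δ(‖X‖² + t²‖Y‖²)` for all `t`; the discriminant of this quadratic is the claim, with no
normalization of `X` and `Y`. -/
theorem abs_inner_map_le_of_frobInner_eq_zero
    {A : Matrix (Fin n₁) (Fin n₂) ℝ →ₗ[ℝ] EuclideanSpace ℝ (Fin m)} {k : ℕ} {δ : ℝ}
    (hδ : 0 ≤ δ) (hA : RIPBound A k δ) {X Y : Matrix (Fin n₁) (Fin n₂) ℝ}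
    (hXY : frobInner X Y = 0) (hr : X.rank + Y.rank ≤ k) :
    |inner ℝ (A X) (A Y)| ≤ δ * frobNorm X * frobNorm Y := by
  have hrank : ∀ t : ℝ, (X + t • Y).rank ≤ k := fun t =>
    (rank_add_le _ _).trans (le_trans (add_le_add le_rfl (by
      simpa using rank_mul_le_right (t • (1 : Matrix (Fin n₁) (Fin n₁) ℝ)) Y)) hr)
  have h : ∀ t : ℝ, 0 ≤ (δ * frobNorm Y ^ 2) * (t * t) + (-2 * inner ℝ (A X) (A Y)) * t +
      δ * frobNorm X ^ 2 := by
    intro t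
    have h1 := (hA _ (hrank t)).2
    have h2 := (hA _ (hrank (-t))).1
    rw [frobNorm_add_sq, frobNorm_smul_sq, frobInner_smul_right, hXY, map_add, map_smul,
      norm_add_sq_real, inner_smul_right, norm_smul, mul_pow, Real.norm_eq_abs, sq_abs] at h1 h2
    nlinarith
  have hd := discrim_le_zero h
  rw [discrim] at hd
  refine abs_le_of_sq_le_sq (by nlinarith) ?_
  exact mul_nonneg (mul_nonneg hδ (frobNorm_nonneg _)) (frobNorm_nonneg _)

/-- Summing a subadditive function of intervals over consecutive blocks of length `k` of a
decreasing sequence, the first block being left out. -/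
theorem le_sum_of_block_le {t : ℕ → ℝ} (ht : Antitone t) (ht0 : ∀ i, 0 ≤ t i) {k : ℕ} (hk : 1 ≤ k)
    {C : ℝ} (hC : 0 ≤ C) {φ : ℕ → ℕ → ℝ} (hadd : ∀ a b c, a ≤ b → b ≤ c → φ a c ≤ φ a b + φ b c)
    (hφ : ∀ a b, k ≤ a → a ≤ b → b ≤ a + k → φ a b ≤ C * √(∑ i ∈ Finset.Ico a b, t i ^ 2))
    (q a : ℕ) :
    φ (a + k) (a + k + q * k) ≤ C / √k * ∑ i ∈ Finset.Ico a (a + q * k), t i := by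
  have hk0 : (0 : ℝ) < k := by exact_mod_cast hk
  induction q generalizing a with
  | zero => simpa using hφ (a + k) (a + k) (by omega) le_rfl (by omega)
  | succ q ih =>
    have h1 := hadd (a + k) (a + k + k) (a + k + (q + 1) * k) (by omega) (by lia)
    have h2 := ih (a + k)
    have h3 := hφ (a + k) (a + k + k) (by omega) (by omega) le_rfl
    have h4 : ∑ i ∈ Finset.Ico (a + k) (a + k + k), t i ^ 2 ≤ k * t (a + k) ^ 2 := by
      have := Finset.sum_le_card_nsmul (Finset.Ico (a + k) (a + k + k)) (fun i => t i ^ 2)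
        (t (a + k) ^ 2) fun i hi =>
          pow_le_pow_left₀ (ht0 i) (ht (Finset.mem_Ico.1 hi).1) 2
      simpa using this
    have h5 : k * t (a + k) ≤ ∑ i ∈ Finset.Ico a (a + k), t i := by
      have := Finset.card_nsmul_le_sum (Finset.Ico a (a + k)) t
        (t (a + k)) fun i hi => ht (Finset.mem_Ico.1 hi).2.le
      simpa using this
    -- Every term of this block is at most `t (a + k)`, and every term of the previous block is at
    -- least that, so an ℓ² norm is paid for by the preceding ℓ¹ norm.
    have h6 : √(∑ i ∈ Finset.Ico (a + k) (a + k + k), t i ^ 2) ≤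
        1 / √k * ∑ i ∈ Finset.Ico a (a + k), t i := by
      refine (Real.sqrt_le_sqrt h4).trans ?_
      rw [Real.sqrt_mul hk0.le, Real.sqrt_sq (ht0 _)]
      refine le_trans (le_of_eq ?_) (mul_le_mul_of_nonneg_left h5 (by positivity))
      rw [one_div, ← mul_assoc, ← div_eq_inv_mul, Real.div_sqrt]
    have h7 := Finset.sum_Ico_consecutive t (m := a) (n := a + k) (k := a + (q + 1) * k)
      (by omega) (by lia)
    have e1 : a + k + k + q * k = a + k + (q + 1) * k := by ring
    have e2 : a + k + q * k = a + (q + 1) * k := by ring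
    rw [e1, e2] at h2
    rw [← h7, mul_add]
    refine h1.trans (add_le_add (h3.trans ?_) h2)
    refine (mul_le_mul_of_nonneg_left h6 hC).trans (le_of_eq ?_)
    ring

/-- A finite sequence, extended by zero. -/
def extendZero {ρ : ℕ} (s : Fin ρ → ℝ) (i : ℕ) : ℝ :=
  if h : i < ρ then s ⟨i, h⟩ else 0

theorem extendZero_coe {ρ : ℕ} (s : Fin ρ → ℝ) (i : Fin ρ) : extendZero s i = s i := by
  simp [extendZero]

theorem extendZero_of_le {ρ : ℕ} (s : Fin ρ → ℝ) {i : ℕ} (h : ρ ≤ i) : extendZero s i = 0 := by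
  simp [extendZero, h.not_gt]

theorem extendZero_nonneg {ρ : ℕ} {s : Fin ρ → ℝ} (hs : ∀ i, 0 ≤ s i) (i : ℕ) :
    0 ≤ extendZero s i := by
  unfold extendZero
  split_ifs
  exacts [hs _, le_rfl]

theorem extendZero_antitone {ρ : ℕ} {s : Fin ρ → ℝ} (hs : ∀ i, 0 ≤ s i) (hs' : Antitone s) :
    Antitone (extendZero s) := by
  intro i j hij
  rcases lt_or_ge j ρ with h | h
  · simpa [extendZero, h, hij.trans_lt h] using hs' (Fin.mk_le_mk.2 hij)
  · rw [extendZero_of_le s h]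
    exact extendZero_nonneg hs i

/-- The restriction of a finite sequence to the indices in `[a, b)`. -/
def segment {ρ : ℕ} (s : Fin ρ → ℝ) (a b : ℕ) (i : Fin ρ) : ℝ :=
  if a ≤ i ∧ i < b then s i else 0

theorem segment_add {ρ : ℕ} (s : Fin ρ → ℝ) {a b c : ℕ} (hab : a ≤ b) (hbc : b ≤ c) :
    segment s a c = segment s a b + segment s b c := by
  ext i
  simp only [segment, Pi.add_apply]
  split_ifs <;> first | omega | simp

theorem segment_eq_self {ρ : ℕ} (s : Fin ρ → ℝ) {b : ℕ} (h : ρ ≤ b) : segment s 0 b = s := by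
  ext i
  simp [segment, i.2.trans_le h]

theorem sum_segment_sq {ρ : ℕ} (s : Fin ρ → ℝ) (a b : ℕ) :
    ∑ i, segment s a b i ^ 2 = ∑ i ∈ Finset.Ico a b, extendZero s i ^ 2 := by
  have h : ∀ i : Fin ρ, segment s a b i ^ 2 =
      (fun i : ℕ => if i ∈ Finset.Ico a b then extendZero s i ^ 2 else 0) i := by
    intro i
    simp only [segment, Finset.mem_Ico, extendZero_coe]
    split_ifs <;> simp
  rw [Finset.sum_congr rfl fun i _ => h i, ← Finset.sum_range (n := ρ)
    (f := fun i : ℕ => if i ∈ Finset.Ico a b then extendZero s i ^ 2 else 0),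
    ← Finset.sum_filter, Finset.filter_mem_eq_inter]
  refine Finset.sum_subset Finset.inter_subset_right fun i hi hi' => ?_
  rw [extendZero_of_le s, zero_pow two_ne_zero]
  by_contra! h
  exact hi' (Finset.mem_inter.2 ⟨Finset.mem_range.2 h, hi⟩)

theorem sum_extendZero {ρ : ℕ} (s : Fin ρ → ℝ) {b : ℕ} (h : ρ ≤ b) :
    ∑ i ∈ Finset.Ico 0 b, extendZero s i = ∑ i, s i := by
  rw [← Finset.range_eq_Ico, ← Finset.sum_subset (Finset.range_subset_range.2 h), Finset.sum_range]
  · exact Finset.sum_congr rfl fun i _ => extendZero_coe s i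
  · intro i _ hi
    exact extendZero_of_le s (by simpa using hi)

theorem rank_segment_le {ρ : ℕ} (U : Matrix (Fin n₁) (Fin ρ) ℝ) (V : Matrix (Fin n₂) (Fin ρ) ℝ)
    (s : Fin ρ → ℝ) (a b : ℕ) : (U * diagonal (segment s a b) * Vᵀ).rank ≤ b - a := by
  refine (rank_mul_le_left _ _).trans ((rank_mul_le_right _ _).trans ?_)
  rw [rank_diagonal, ← Nat.card_Ico, ← Fintype.card_coe (Finset.Ico a b)]
  refine Fintype.card_le_of_injective (fun i => ⟨i.1, ?_⟩) fun i j hij => ?_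
  · have := i.2
    by_contra h
    rw [Finset.mem_Ico] at h
    exact this (if_neg h)
  · simpa [Subtype.ext_iff, Fin.ext_iff] using hij

/-! ### Decomposition along a low-rank matrix and the cone bound. -/

/-- Splitting off the part of `H` that is orthogonal to the row and column spaces of `M`. -/
theorem exists_orthogonal_decomposition (M H : Matrix (Fin n₁) (Fin n₂) ℝ) {r : ℕ}
    (hM : M.rank ≤ r) :
    ∃ (H₀ : Matrix (Fin n₁) (Fin n₂) ℝ) (ρ : ℕ) (U : Matrix (Fin n₁) (Fin ρ) ℝ)
      (V : Matrix (Fin n₂) (Fin ρ) ℝ) (s : Fin ρ → ℝ), Uᵀ * U = 1 ∧ Vᵀ * V = 1 ∧ (∀ i, 0 < s i) ∧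
      Antitone s ∧ H = H₀ + U * diagonal s * Vᵀ ∧ H₀.rank ≤ 2 * r ∧
      nuclearNorm M + ∑ i, s i ≤ nuclearNorm (M + U * diagonal s * Vᵀ) ∧
      ∀ d : Fin ρ → ℝ, frobInner H₀ (U * diagonal d * Vᵀ) = 0 := by
  obtain ⟨U₁, V₁, s₁, hU₁, hV₁, hs₁, -, hMeq, hMn⟩ := exists_svd M
  set P := U₁ * U₁ᵀ with hP
  set Q := V₁ * V₁ᵀ with hQ
  obtain ⟨U, V, s, hU, hV, hs, hs', hHc, -⟩ := exists_svd ((1 - P) * H * (1 - Q))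
  have hUU : U₁ᵀ * U = 0 := by
    have h1 : U₁ᵀ * (U * diagonal s * Vᵀ) = 0 := by
      have h2 : U₁ᵀ * (1 - P) = 0 := by
        rw [Matrix.mul_sub, Matrix.mul_one, hP, ← Matrix.mul_assoc, hU₁, Matrix.one_mul, sub_self]
      rw [← hHc, ← Matrix.mul_assoc, ← Matrix.mul_assoc, h2]
      simp
    -- As the `s i` are nonzero, `U` is recovered from `U * diagonal s * Vᵀ` by right
    -- multiplication, so it inherits the annihilation by `U₁ᵀ`.
    calc U₁ᵀ * U = U₁ᵀ * (U * diagonal s * Vᵀ) * V * diagonal (fun i => (s i)⁻¹) := by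
          have : U₁ᵀ * (U * diagonal s * Vᵀ) * V * diagonal (fun i => (s i)⁻¹) =
              U₁ᵀ * U * (diagonal s * (Vᵀ * V) * diagonal (fun i => (s i)⁻¹)) := by
            simp only [Matrix.mul_assoc]
          rw [this, hV, Matrix.mul_one, diagonal_mul_diagonal]
          simp [fun i => mul_inv_cancel₀ (hs i).ne']
      _ = 0 := by rw [h1]; simp
  have hVV : Vᵀ * V₁ = 0 := by
    have h1 : (U * diagonal s * Vᵀ) * V₁ = 0 := by
      have h2 : (1 - Q) * V₁ = 0 := by
        rw [Matrix.sub_mul, Matrix.one_mul, hQ, Matrix.mul_assoc, hV₁, Matrix.mul_one, sub_self]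
      rw [← hHc, Matrix.mul_assoc, h2]
      simp
    calc Vᵀ * V₁ = diagonal (fun i => (s i)⁻¹) * Uᵀ * (U * diagonal s * Vᵀ * V₁) := by
          have : diagonal (fun i => (s i)⁻¹) * Uᵀ * (U * diagonal s * Vᵀ * V₁) =
              diagonal (fun i => (s i)⁻¹) * (Uᵀ * U) * diagonal s * (Vᵀ * V₁) := by
            simp only [Matrix.mul_assoc]
          rw [this, hU, Matrix.mul_one, diagonal_mul_diagonal]
          simp [fun i => inv_mul_cancel₀ (hs i).ne']
      _ = 0 := by rw [h1]; simp
  have hUU' : Uᵀ * U₁ = 0 := by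
    rw [← transpose_transpose U₁, ← transpose_mul, hUU, transpose_zero]
  have hVV' : V₁ᵀ * V = 0 := by
    rw [← transpose_transpose V, ← transpose_mul, hVV, transpose_zero]
  refine ⟨P * H + (1 - P) * H * Q, _, U, V, s, hU, hV, hs, hs', ?_, ?_, ?_, ?_⟩
  · rw [← hHc]
    simp only [Matrix.sub_mul, Matrix.mul_sub, Matrix.one_mul, Matrix.mul_one]
    abel
  · refine (rank_add_le _ _).trans ?_
    rw [two_mul]
    refine add_le_add ?_ ?_
    · rw [hP, Matrix.mul_assoc]
      exact (rank_mul_le_left _ _).trans ((rank_le_width U₁).trans hM)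
    · rw [hQ, ← Matrix.mul_assoc]
      exact (rank_mul_le_right _ _).trans ((rank_le_height V₁ᵀ).trans hM)
  -- Concatenated, the two pairs of factors still have orthonormal columns, so they factor `M + Hc`
  -- with diagonal `s₁` followed by `s`.
  · have hUs : (fromCols U₁ U)ᵀ * fromCols U₁ U = 1 := by
      rw [transpose_fromCols, fromRows_mul_fromCols, hU₁, hU, hUU, hUU', fromBlocks_one]
    have hVs : (fromCols V₁ V)ᵀ * fromCols V₁ V = 1 := by
      rw [transpose_fromCols, fromRows_mul_fromCols, hV₁, hV, hVV, hVV', fromBlocks_one]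
    have h := sum_le_nuclearNorm_factor hUs hVs (Sum.elim s₁ s)
    rw [← fromBlocks_diagonal, fromCols_mul_fromBlocks, transpose_fromCols,
      fromCols_mul_fromRows, Fintype.sum_sum_type] at h
    simpa [hMn, ← hMeq] using h
  · intro d
    rw [frobInner, transpose_add, Matrix.add_mul, trace_add]
    have h1 : (P * H)ᵀ * (U * diagonal d * Vᵀ) = 0 := by
      have : (P * H)ᵀ * (U * diagonal d * Vᵀ) = Hᵀ * U₁ * (U₁ᵀ * U) * diagonal d * Vᵀ := by
        simp only [hP, transpose_mul, transpose_transpose, Matrix.mul_assoc]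
      rw [this, hUU]
      simp
    have h2 : (((1 - P) * H * Q)ᵀ * (U * diagonal d * Vᵀ)).trace = 0 := by
      have : ((1 - P) * H * Q)ᵀ * (U * diagonal d * Vᵀ) =
          V₁ * (V₁ᵀ * (((1 - P) * H)ᵀ * (U * diagonal d * Vᵀ))) := by
        have hQt : Qᵀ = V₁ * V₁ᵀ := by rw [hQ, transpose_mul, transpose_transpose]
        rw [transpose_mul, hQt, Matrix.mul_assoc, Matrix.mul_assoc]
      rw [this, trace_mul_comm]
      have h3 : V₁ᵀ * (((1 - P) * H)ᵀ * (U * diagonal d * Vᵀ)) * V₁ =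
          V₁ᵀ * (((1 - P) * H)ᵀ * (U * diagonal d * (Vᵀ * V₁))) := by
        simp only [Matrix.mul_assoc]
      rw [h3, hVV]
      simp
    rw [h1, h2, trace_zero, add_zero]

/-- The error bound for matrices in a cone around a low-rank matrix. -/
theorem frobNorm_le_of_cone {A : Matrix (Fin n₁) (Fin n₂) ℝ →ₗ[ℝ] EuclideanSpace ℝ (Fin m)}
    {r : ℕ} (hr : 1 ≤ r) {δ : ℝ} (hδ : 0 ≤ δ) (hA : RIPBound A (4 * r) δ)
    {M H : Matrix (Fin n₁) (Fin n₂) ℝ} (hM : M.rank ≤ r) {κ τ : ℝ} (hκ : 0 ≤ κ)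
    (hκδ : (1 + κ * √2) * δ < 1) (hτ : opNorm (adj A (A H)) ≤ τ)
    (hcone : ∀ (H₀ Hc : Matrix (Fin n₁) (Fin n₂) ℝ) (c : ℝ), H = H₀ + Hc →
      nuclearNorm Hc ≤ c → nuclearNorm M + c ≤ nuclearNorm (M + Hc) → c ≤ κ * nuclearNorm H₀) :
    frobNorm H ^ 2 ≤ ((1 + κ) * 2 / (1 - (1 + κ * √2) * δ)) ^ 2 * r * τ ^ 2 := by
  obtain ⟨H₀, ρ, U, V, s, hU, hV, hs, hs', hH, hrank, hnuc, horth⟩ :=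
    exists_orthogonal_decomposition M H hM
  have hs0 : ∀ i, 0 ≤ s i := fun i => (hs i).le
  have hc := hcone H₀ _ _ hH (nuclearNorm_factor_le hU hV hs0) hnuc
  set k := 2 * r with hk
  have hk1 : 1 ≤ k := by omega
  have hk0 : (0 : ℝ) < k := by exact_mod_cast hk1
  -- After the first block, `ρ` further blocks of length `k ≥ 1` surely exhaust the `ρ` singular
  -- values.
  set N := k + ρ * k with hN
  have hρ : ρ ≤ ρ * k := Nat.le_mul_of_pos_right _ hk1
  set S : ℕ → ℕ → Matrix (Fin n₁) (Fin n₂) ℝ :=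
    fun a b => U * diagonal (segment s a b) * Vᵀ with hS
  have hSadd : ∀ a b c, a ≤ b → b ≤ c → S a c = S a b + S b c := by
    intro a b c hab hbc
    simp only [hS, segment_add s hab hbc]
    rw [← Matrix.add_mul, ← Matrix.mul_add, diagonal_add]
    rfl
  have hSF : ∀ a b, frobNorm (S a b) = √(∑ i ∈ Finset.Ico a b, extendZero s i ^ 2) := by
    intro a b
    rw [← sum_segment_sq, ← frobNorm_factor_sq hU hV, Real.sqrt_sq (frobNorm_nonneg _)]
  have hSr : ∀ a b, (S a b).rank ≤ b - a := fun a b => rank_segment_le U V s a b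
  set X := H₀ + S 0 k with hX
  have hHX : H = X + S k N := by
    rw [hX, add_assoc, ← hSadd 0 k N (by omega) (by omega), hH]
    simp only [hS]
    rw [segment_eq_self s (by omega)]
  have hXF : frobNorm X ^ 2 = frobNorm H₀ ^ 2 + frobNorm (S 0 k) ^ 2 := by
    rw [hX, frobNorm_add_sq, horth]
    ring
  set x := frobNorm X with hx
  set a := frobNorm H₀ with ha
  set b := frobNorm (S 0 k) with hb
  have hx0 : 0 ≤ x := frobNorm_nonneg _
  have ha0 : 0 ≤ a := frobNorm_nonneg _
  have hb0 : 0 ≤ b := frobNorm_nonneg _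
  have hax : a ≤ x := le_of_sq_le_sq (by nlinarith) hx0
  have habx : a + b ≤ √2 * x := by
    refine le_of_sq_le_sq ?_ (by positivity)
    rw [mul_pow, Real.sq_sqrt zero_le_two, hXF]
    nlinarith [sq_nonneg (a - b)]
  have hsum : 1 / √k * ∑ i, s i ≤ κ * a := by
    have h1 : nuclearNorm H₀ ≤ √k * a := nuclearNorm_le_sqrt_rank_mul_frobNorm H₀ hrank
    have h2 : 0 < √(k : ℝ) := Real.sqrt_pos.2 hk0
    rw [one_div, inv_mul_le_iff₀ h2]
    nlinarith
  have ht := extendZero_antitone hs0 hs'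
  have ht0 := extendZero_nonneg hs0
  have hrest : frobNorm (S k N) ≤ κ * a := by
    have := le_sum_of_block_le ht ht0 hk1 zero_le_one (φ := fun a b => frobNorm (S a b))
      (fun a b c hab hbc => by
        simp only [hSadd a b c hab hbc]
        exact frobNorm_add_le _ _)
      (fun a b _ _ _ => by simp only [hSF, one_mul, le_refl]) ρ 0
    rw [zero_add, zero_add, sum_extendZero s hρ] at this
    exact this.trans hsum
  -- The two summands of `X` are treated separately: each has rank at most `2r`, so with one block
  -- the total stays within `4r`, whereas `X` and a block could reach `6r`. The price is `a + b ≤ √2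
  -- x`.
  have hcross : |inner ℝ (A X) (A (S k N))| ≤ √2 * κ * δ * x ^ 2 := by
    have := le_sum_of_block_le ht ht0 hk1 (C := δ * (a + b)) (by positivity)
      (φ := fun a b => |inner ℝ (A X) (A (S a b))|)
      (fun a b c hab hbc => by
        simp only [hSadd a b c hab hbc, map_add, inner_add_right]
        exact abs_add_le _ _)
      (fun i j hi hij hj => by
        rw [← hSF]
        have hrk := hSr i j
        have h1 := abs_inner_map_le_of_frobInner_eq_zero hδ hA (horth (segment s i j))
          (show H₀.rank + (S i j).rank ≤ 4 * r by omega)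
        have h0 : frobInner (S 0 k) (S i j) = 0 := by
          simp only [hS]
          rw [frobInner_factor_factor hU hV]
          refine Finset.sum_eq_zero fun l _ => ?_
          simp only [segment]
          split_ifs <;> first | omega | simp
        have h2 := abs_inner_map_le_of_frobInner_eq_zero hδ hA h0
          (by have := hSr 0 k; omega)
        rw [hX, map_add, inner_add_left]
        refine (abs_add_le _ _).trans ((add_le_add h1 h2).trans (le_of_eq ?_))
        ring) ρ 0
    rw [zero_add, zero_add, sum_extendZero s hρ] at this
    calc |inner ℝ (A X) (A (S k N))| ≤ δ * (a + b) * (1 / √k * ∑ i, s i) := by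
          refine this.trans (le_of_eq ?_)
          ring
      _ ≤ δ * (√2 * x) * (κ * x) := by
          refine mul_le_mul (mul_le_mul_of_nonneg_left habx hδ)
            (hsum.trans (mul_le_mul_of_nonneg_left hax hκ)) ?_ (by positivity)
          exact mul_nonneg (by positivity) (Finset.sum_nonneg fun i _ => hs0 i)
      _ = _ := by ring
  have hXr : X.rank ≤ 4 * r := by
    refine (rank_add_le H₀ (S 0 k)).trans ?_
    have := hSr 0 k
    omega
  have hτ0 : 0 ≤ τ := (opNorm_nonneg _).trans hτ
  -- Lower isometry at `X`, with `A X = A H - A (S k N)`; the first term is bounded by trace duality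
  -- and `‖X‖_* ≤ √(4r) ‖X‖_F`.
  have hmain : (1 - δ) * x ^ 2 ≤ τ * (2 * √r * x) + √2 * κ * δ * x ^ 2 := by
    have h1 := (hA X hXr).1
    have h2 : ‖A X‖ ^ 2 = inner ℝ (A H) (A X) - inner ℝ (A X) (A (S k N)) := by
      have : A H = A X + A (S k N) := hHX ▸ map_add A _ _
      rw [this, inner_add_left, real_inner_self_eq_norm_sq,
        real_inner_comm (A X) (A (S k N))]
      ring
    have h3 : inner ℝ (A H) (A X) ≤ τ * (2 * √r * x) := by
      rw [← frobInner_adj]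
      have h4 := nuclearNorm_le_sqrt_rank_mul_frobNorm X hXr
      have h5 : √((4 * r : ℕ) : ℝ) = 2 * √r := by
        rw [Nat.cast_mul, Real.sqrt_mul (by positivity)]
        congr 1
        rw [show ((4 : ℕ) : ℝ) = 2 ^ 2 by norm_num, Real.sqrt_sq zero_le_two]
      rw [h5] at h4
      exact (frobInner_le_opNorm_mul_nuclearNorm _ _).trans
        (mul_le_mul hτ h4 (nuclearNorm_nonneg _) hτ0)
    linarith [(abs_le.1 hcross).1]
  set η := 1 - (1 + κ * √2) * δ with hη
  have hη0 : 0 < η := by linarith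
  have hxle : x ≤ 2 * τ * √r / η := by
    rw [le_div_iff₀ hη0]
    rcases hx0.eq_or_lt with h | h
    · rw [← h, zero_mul]
      positivity
    · refine le_of_mul_le_mul_right ?_ h
      linarith
  have hHle : frobNorm H ≤ (1 + κ) * (2 * τ * √r / η) := by
    rw [hHX]
    refine (frobNorm_add_le _ _).trans ?_
    nlinarith
  refine (pow_le_pow_left₀ (frobNorm_nonneg _) hHle 2).trans (le_of_eq ?_)
  have : √(r : ℝ) ^ 2 = r := Real.sq_sqrt (Nat.cast_nonneg _)
  rw [show (1 + κ) * (2 * τ * √r / η) = (1 + κ) * 2 / η * τ * √r by ring, mul_pow, mul_pow, this]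
  ring

/-! ### Deterministic error bounds. -/

theorem frobNorm_eq_zero_of_isEmpty (h : n₁ = 0 ∨ n₂ = 0) (X : Matrix (Fin n₁) (Fin n₂) ℝ) :
    frobNorm X = 0 := by
  rcases h with rfl | rfl <;> simp [frobNorm]

theorem isometryConst_nonneg (A : Matrix (Fin n₁) (Fin n₂) ℝ →ₗ[ℝ] EuclideanSpace ℝ (Fin m))
    {r : ℕ} (hr : 1 ≤ r) (h₁ : 1 ≤ n₁) (h₂ : 1 ≤ n₂) : 0 ≤ isometryConst A r := by
  have h := (isLeast_isometryConst A hr h₁ h₂).1 (single ⟨0, h₁⟩ ⟨0, h₂⟩ 1) (by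
    rw [single_eq_single_vecMulVec_single]
    exact (rank_vecMulVec_le _ _).trans hr)
  have hF : frobNorm (single (⟨0, h₁⟩ : Fin n₁) (⟨0, h₂⟩ : Fin n₂) (1 : ℝ)) ^ 2 = 1 := by
    rw [frobNorm_sq]
    simp [single_apply, ite_and]
  rw [hF] at h
  linarith [h.1, h.2]

theorem adj_add (A : Matrix (Fin n₁) (Fin n₂) ℝ →ₗ[ℝ] EuclideanSpace ℝ (Fin m))
    (p q : EuclideanSpace ℝ (Fin m)) : adj A (p + q) = adj A p + adj A q := by
  ext
  simp [adj, inner_add_right]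

theorem adj_neg (A : Matrix (Fin n₁) (Fin n₂) ℝ →ₗ[ℝ] EuclideanSpace ℝ (Fin m))
    (p : EuclideanSpace ℝ (Fin m)) : adj A (-p) = -adj A p := by
  ext
  simp [adj]

theorem opNorm_add_le (X Y : Matrix (Fin n₁) (Fin n₂) ℝ) :
    opNorm (X + Y) ≤ opNorm X + opNorm Y := by
  rw [opNorm, map_add, map_add]
  exact norm_add_le _ _

theorem opNorm_adj_map_sub_le (A : Matrix (Fin n₁) (Fin n₂) ℝ →ₗ[ℝ] EuclideanSpace ℝ (Fin m))
    (M X : Matrix (Fin n₁) (Fin n₂) ℝ) (z : EuclideanSpace ℝ (Fin m)) :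
    opNorm (adj A (A (X - M))) ≤ opNorm (adj A z) + opNorm (adj A (A M + z - A X)) := by
  have : A (X - M) = z + -(A M + z - A X) := by
    rw [map_sub]
    abel
  rw [this, adj_add, adj_neg, ← opNorm_neg (adj A (A M + z - A X))]
  exact opNorm_add_le _ _

theorem nuclearNorm_add_le_add_decomposition {M H H₀ Hc : Matrix (Fin n₁) (Fin n₂) ℝ}
    (h : H = H₀ + Hc) : nuclearNorm (M + Hc) ≤ nuclearNorm (M + H) + nuclearNorm H₀ := by
  have : M + Hc = M + H + -H₀ := by
    rw [h]
    abel
  rw [this]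
  exact (nuclearNorm_add_le _ _).trans (add_le_add le_rfl (nuclearNorm_neg_le _))

/-- The residual at `M` is `z`, so `M` is feasible and `‖X‖_* ≤ ‖M‖_*`. Hence `‖M‖_* + c ≤ ‖M +
Hc‖_* ≤ ‖M‖_* + ‖H₀‖_*`, the cone condition with `κ = 1`. -/
theorem dantzig_error_le {A : Matrix (Fin n₁) (Fin n₂) ℝ →ₗ[ℝ] EuclideanSpace ℝ (Fin m)}
    {r : ℕ} (hr : 1 ≤ r) {M : Matrix (Fin n₁) (Fin n₂) ℝ} (hM : M.rank ≤ r)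
    (hδ : isometryConst A (4 * r) < √2 - 1) {z : EuclideanSpace ℝ (Fin m)} {lam : ℝ}
    (hz : opNorm (adj A z) ≤ lam) {X : Matrix (Fin n₁) (Fin n₂) ℝ}
    (hX : IsDantzigSolution A (A M + z) lam X) :
    frobNorm (X - M) ^ 2 ≤
      (4 / (1 - (1 + √2) * isometryConst A (4 * r))) ^ 2 * 4 * r * lam ^ 2 := by
  -- For empty matrices every real `δ` satisfies the isometry bound, so the constant is no minimum;
  -- but the error is zero.
  by_cases hn : n₁ = 0 ∨ n₂ = 0
  · rw [frobNorm_eq_zero_of_isEmpty hn, zero_pow two_ne_zero]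
    positivity
  push Not at hn
  have h₁ := Nat.one_le_iff_ne_zero.2 hn.1
  have h₂ := Nat.one_le_iff_ne_zero.2 hn.2
  have hr4 : 1 ≤ 4 * r := by omega
  have h := frobNorm_le_of_cone hr (isometryConst_nonneg A hr4 h₁ h₂)
    (isLeast_isometryConst A hr4 h₁ h₂).1 (H := X - M) (τ := 2 * lam) hM zero_le_one (by
      nlinarith [Real.sq_sqrt zero_le_two, Real.sqrt_nonneg 2]) (by
      linarith [opNorm_adj_map_sub_le A M X z, hX.1]) (by
      intro H₀ Hc c hH _ hc
      have h1 := nuclearNorm_add_le_add_decomposition (M := M) hH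
      have h2 := hX.2 M (by rwa [add_sub_cancel_left])
      rw [add_sub_cancel] at h1
      linarith)
  refine h.trans (le_of_eq ?_)
  norm_num
  ring

/-- First-order optimality: moving `X` by `t u vᵀ` raises the penalty by at most `μ t` and changes
the quadratic term by `-t⟨y - A X, A(u vᵀ)⟩ + O(t²)`; divide by `t` and let `t` tend to `0` from
above. -/
theorem IsLassoSolution.opNorm_adj_le
    {A : Matrix (Fin n₁) (Fin n₂) ℝ →ₗ[ℝ] EuclideanSpace ℝ (Fin m)}
    {y : EuclideanSpace ℝ (Fin m)} {μ : ℝ} (hμ : 0 ≤ μ) {X : Matrix (Fin n₁) (Fin n₂) ℝ}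
    (hX : IsLassoSolution A y μ X) : opNorm (adj A (y - A X)) ≤ μ := by
  refine opNorm_le_of_unit hμ fun u v hu hv => ?_
  rw [← frobInner_vecMulVec, frobInner_adj]
  set W := vecMulVec u.ofLp v.ofLp with hW
  have hWn : nuclearNorm W ≤ 1 := nuclearNorm_vecMulVec_le hu hv
  have key : ∀ t : ℝ, 0 < t → inner ℝ (y - A X) (A W) - μ ≤ t * (‖A W‖ ^ 2 / 2) := by
    intro t ht
    have h := hX (X + t • W)
    have h1 : nuclearNorm (t • W) ≤ t := by
      obtain ⟨Z, hZ, h⟩ := nuclearNorm_dual (t • W)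
      rw [h, frobInner_smul_right]
      have h2 := frobInner_le_opNorm_mul_nuclearNorm Z W
      have h3 : opNorm Z * nuclearNorm W ≤ 1 := mul_le_one₀ hZ (nuclearNorm_nonneg _) hWn
      nlinarith
    have h2 : A (X + t • W) - y = -(y - A X) + t • A W := by
      rw [map_add, map_smul]
      abel
    have h3 : A X - y = -(y - A X) := by abel
    rw [h2, h3, norm_add_sq_real, norm_neg, inner_neg_left, inner_smul_right, norm_smul, mul_pow,
      Real.norm_eq_abs, sq_abs] at h
    have h4 : μ * nuclearNorm (X + t • W) ≤ μ * (nuclearNorm X + t) :=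
      mul_le_mul_of_nonneg_left ((nuclearNorm_add_le _ _).trans (by linarith)) hμ
    refine le_of_mul_le_mul_left ?_ ht
    nlinarith
  have hlim : Filter.Tendsto (fun t : ℝ => t * (‖A W‖ ^ 2 / 2)) (nhdsWithin 0 (Set.Ioi 0))
      (nhds 0) := by
    have : Filter.Tendsto (fun t : ℝ => t * (‖A W‖ ^ 2 / 2)) (nhds 0)
        (nhds (0 * (‖A W‖ ^ 2 / 2))) := (continuous_id.mul continuous_const).tendsto 0
    rw [zero_mul] at this
    exact this.mono_left nhdsWithin_le_nhds
  have := ge_of_tendsto hlim (Filter.eventually_of_mem self_mem_nhdsWithin key)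
  linarith

/-- Comparing the objective at `X` and `M`, with `‖A* z‖ ≤ μ/2`, gives `‖X‖_* ≤ ‖M‖_* + ‖H‖_*/2`. So
`c ≤ (‖H₀‖_* + c)/2 + ‖H₀‖_*`, the cone condition with `κ = 3`. -/
theorem lasso_error_le {A : Matrix (Fin n₁) (Fin n₂) ℝ →ₗ[ℝ] EuclideanSpace ℝ (Fin m)}
    {r : ℕ} (hr : 1 ≤ r) {M : Matrix (Fin n₁) (Fin n₂) ℝ} (hM : M.rank ≤ r)
    (hδ : isometryConst A (4 * r) < (3 * √2 - 1) / 17) {z : EuclideanSpace ℝ (Fin m)} {μ : ℝ}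
    (hμ : 0 < μ) (hz : opNorm (adj A z) ≤ μ / 2) {X : Matrix (Fin n₁) (Fin n₂) ℝ}
    (hX : IsLassoSolution A (A M + z) μ X) :
    frobNorm (X - M) ^ 2 ≤
      (12 / (1 - (1 + 3 * √2) * isometryConst A (4 * r))) ^ 2 * r * μ ^ 2 := by
  by_cases hn : n₁ = 0 ∨ n₂ = 0
  · rw [frobNorm_eq_zero_of_isEmpty hn, zero_pow two_ne_zero]
    positivity
  push Not at hn
  have h₁ := Nat.one_le_iff_ne_zero.2 hn.1
  have h₂ := Nat.one_le_iff_ne_zero.2 hn.2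
  have hr4 : 1 ≤ 4 * r := by omega
  have h := frobNorm_le_of_cone hr (isometryConst_nonneg A hr4 h₁ h₂)
    (isLeast_isometryConst A hr4 h₁ h₂).1 (H := X - M) (κ := 3) (τ := 3 / 2 * μ) hM
    (by norm_num) (by
      nlinarith [Real.sq_sqrt zero_le_two, Real.sqrt_nonneg 2]) (by
      linarith [opNorm_adj_map_sub_le A M X z, hX.opNorm_adj_le hμ.le]) (by
      intro H₀ Hc c hH hHc hc
      have h1 := nuclearNorm_add_le_add_decomposition (M := M) hH
      rw [add_sub_cancel] at h1
      have h2 := hX M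
      have h3 : A X - (A M + z) = A (X - M) - z := by
        rw [map_sub]
        abel
      rw [h3, norm_sub_sq_real, sub_add_cancel_left, norm_neg, real_inner_comm,
        ← frobInner_adj] at h2
      have h4 := (frobInner_le_opNorm_mul_nuclearNorm (adj A z) (X - M)).trans
        (mul_le_mul_of_nonneg_right hz (nuclearNorm_nonneg _))
      have h5 := nuclearNorm_add_le H₀ Hc
      rw [← hH] at h5
      have h6 : nuclearNorm X ≤ nuclearNorm M + 1 / 2 * nuclearNorm (X - M) := by
        refine le_of_mul_le_mul_left ?_ hμ
        linarith [sq_nonneg ‖A (X - M)‖]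
      linarith)
  refine h.trans (le_of_eq ?_)
  ring

/-! ### Nets on the sphere and Gaussian noise. -/

section Net

open Metric Module
open scoped ENNReal

/-- Volume comparison: disjoint balls of radius 1/8 lie in a ball of radius 9/8. -/
theorem card_le_of_separated_unit {E : Type*} [NormedAddCommGroup E] [NormedSpace ℝ E]
    [FiniteDimensional ℝ E] (s : Finset E) (hs : ∀ x ∈ s, ‖x‖ = 1)
    (h : ∀ x ∈ s, ∀ y ∈ s, x ≠ y → 1 / 4 ≤ ‖x - y‖) : s.card ≤ 9 ^ finrank ℝ E := by
  borelize E
  let μ : Measure E := Measure.addHaar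
  have D : Set.Pairwise (s : Set E) (Function.onFun Disjoint fun x => ball (x : E) (1 / 8)) := by
    rintro x hx y hy hxy
    refine ball_disjoint_ball ?_
    rw [dist_eq_norm]
    linarith [h x hx y hy hxy]
  have hsub : ⋃ x ∈ s, ball (x : E) (1 / 8) ⊆ ball (0 : E) (9 / 8) := by
    refine Set.iUnion₂_subset fun x hx => ball_subset_ball' ?_
    rw [dist_zero_right, hs x hx]
    norm_num
  have I : (s.card : ℝ≥0∞) * ENNReal.ofReal ((1 / 8) ^ finrank ℝ E) * μ (ball 0 1) ≤
      ENNReal.ofReal ((9 / 8) ^ finrank ℝ E) * μ (ball 0 1) := by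
    calc (s.card : ℝ≥0∞) * ENNReal.ofReal ((1 / 8) ^ finrank ℝ E) * μ (ball 0 1) =
          μ (⋃ x ∈ s, ball (x : E) (1 / 8)) := by
          rw [measure_biUnion_finset D fun x _ => measurableSet_ball]
          simp only [μ.addHaar_ball_of_pos _ (show (0 : ℝ) < 1 / 8 by norm_num),
            Finset.sum_const, nsmul_eq_mul, mul_assoc]
      _ ≤ μ (ball (0 : E) (9 / 8)) := measure_mono hsub
      _ = _ := by rw [μ.addHaar_ball_of_pos _ (by norm_num)]
  have J := (ENNReal.mul_le_mul_iff_left (measure_ball_pos _ _ zero_lt_one).ne'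
    measure_ball_lt_top.ne).1 I
  have K : (s.card : ℝ) ≤ (9 : ℝ) ^ finrank ℝ E := by
    have := ENNReal.toReal_le_of_le_ofReal (by positivity) J
    rw [ENNReal.toReal_mul, ENNReal.toReal_natCast, ENNReal.toReal_ofReal (by positivity)] at this
    rw [← mul_le_mul_iff_left₀ (show (0 : ℝ) < (1 / 8) ^ finrank ℝ E by positivity), ← mul_pow]
    convert! this using 2
    norm_num
  exact_mod_cast K

/-- A separated set of maximal cardinality is a net, since an uncovered unit vector could be added.
-/
theorem exists_net_unit (E : Type*) [NormedAddCommGroup E] [NormedSpace ℝ E]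
    [FiniteDimensional ℝ E] : ∃ s : Finset E, s.card ≤ 9 ^ finrank ℝ E ∧ (∀ x ∈ s, ‖x‖ = 1) ∧
      ∀ x : E, ‖x‖ = 1 → ∃ y ∈ s, ‖x - y‖ ≤ 1 / 4 := by
  classical
  set K : Set ℕ := {k | ∃ s : Finset E, s.card = k ∧ (∀ x ∈ s, ‖x‖ = 1) ∧
    ∀ x ∈ s, ∀ y ∈ s, x ≠ y → 1 / 4 ≤ ‖x - y‖} with hK
  have hbdd : BddAbove K := by
    refine ⟨9 ^ finrank ℝ E, ?_⟩
    rintro _ ⟨s, rfl, h1, h2⟩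
    exact card_le_of_separated_unit s h1 h2
  have hne : K.Nonempty := ⟨0, ∅, by simp⟩
  obtain ⟨s, hcard, h1, h2⟩ := Nat.sSup_mem hne hbdd
  refine ⟨s, card_le_of_separated_unit s h1 h2, h1, fun x hx => ?_⟩
  by_contra! hcon
  have hxs : x ∉ s := fun h => by
    have := hcon x h
    rw [sub_self, norm_zero] at this
    linarith
  have hmem : (insert x s).card ∈ K := by
    refine ⟨insert x s, rfl, ?_, ?_⟩
    · intro y hy
      rcases Finset.mem_insert.1 hy with rfl | hy
      exacts [hx, h1 y hy]
    · intro y hy w hw hyw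
      rcases Finset.mem_insert.1 hy with hy' | hy' <;>
        rcases Finset.mem_insert.1 hw with hw' | hw'
      · exact absurd (hy'.trans hw'.symm) hyw
      · rw [hy']
        exact (hcon w hw').le
      · rw [hw', norm_sub_rev]
        exact (hcon y hy').le
      · exact h2 y hy' w hw' hyw
  have := le_csSup hbdd hmem
  rw [Finset.card_insert_of_notMem hxs, hcard] at this
  omega

end Net

/-- Replacing `u` and then `v` by net points costs `‖Y‖/4` each, so `‖Y‖ ≤ c + ‖Y‖/2`. -/
theorem opNorm_le_two_mul_of_net {Y : Matrix (Fin n₁) (Fin n₂) ℝ}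
    {S : Finset (EuclideanSpace ℝ (Fin n₁))} {T : Finset (EuclideanSpace ℝ (Fin n₂))}
    (hS : ∀ u, ‖u‖ = 1 → ∃ u' ∈ S, ‖u - u'‖ ≤ 1 / 4)
    (hS1 : ∀ u ∈ S, ‖u‖ = 1) (hT : ∀ v, ‖v‖ = 1 → ∃ v' ∈ T, ‖v - v'‖ ≤ 1 / 4)
    {c : ℝ} (hc : 0 ≤ c) (h : ∀ u ∈ S, ∀ v ∈ T, u.ofLp ⬝ᵥ Y *ᵥ v.ofLp ≤ c) :
    opNorm Y ≤ 2 * c := by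
  have hY := opNorm_nonneg Y
  have : opNorm Y ≤ c + opNorm Y / 2 := by
    refine opNorm_le_of_unit (by positivity) fun u v hu hv => ?_
    obtain ⟨u', hu', hd⟩ := hS u hu
    obtain ⟨v', hv', hd'⟩ := hT v hv
    have h1 := dotProduct_mulVec_le_opNorm Y (u - u') v
    have h2 := dotProduct_mulVec_le_opNorm Y u' (v - v')
    have h3 := h u' hu' v' hv'
    rw [hv, WithLp.ofLp_sub, sub_dotProduct] at h1
    rw [hS1 u' hu', WithLp.ofLp_sub, mulVec_sub, dotProduct_sub] at h2
    nlinarith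
  linarith

theorem hasSubgaussianMGF_mono {Ω : Type*} [MeasurableSpace Ω] {P : Measure Ω} {X : Ω → ℝ}
    {c d : ℝ≥0} (h : HasSubgaussianMGF X c P) (hcd : c ≤ d) : HasSubgaussianMGF X d P where
  integrable_exp_mul := h.integrable_exp_mul
  mgf_le t := (h.mgf_le t).trans (by gcongr)

theorem hasSubgaussianMGF_of_hasLaw_gaussianReal {Ω : Type*} [MeasurableSpace Ω] {P : Measure Ω}
    {X : Ω → ℝ} {v : ℝ≥0} (h : HasLaw X (gaussianReal 0 v) P) : HasSubgaussianMGF X v P where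
  integrable_exp_mul t := by
    have h1 := integrable_exp_mul_gaussianReal (μ := 0) (v := v) t
    rw [← h.map_eq] at h1
    exact h1.comp_aemeasurable h.aemeasurable
  mgf_le t := by
    rw [mgf_gaussianReal h.map_eq]
    simp

theorem IsGaussianNoise.hasSubgaussianMGF_inner {Ω : Type*} [MeasurableSpace Ω] {P : Measure Ω}
    {σ : ℝ≥0} {z : Ω → EuclideanSpace ℝ (Fin m)} (hz : IsGaussianNoise P σ z)
    (a : EuclideanSpace ℝ (Fin m)) :
    HasSubgaussianMGF (fun ω => inner ℝ (z ω) a) (‖a‖₊ ^ 2 * σ ^ 2) P := by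
  have hind : iIndepFun (fun i ω => a i * z ω i) P :=
    hz.indep.comp (fun i x => a i * x) fun i => measurable_const_mul _
  have h1 : ∀ i, HasSubgaussianMGF (fun ω => a i * z ω i) (‖a i‖₊ ^ 2 * σ ^ 2) P := fun i =>
    hasSubgaussianMGF_mono ((hasSubgaussianMGF_of_hasLaw_gaussianReal (hz.law i)).const_mul (a i))
      (mul_le_mul_of_nonneg_right (le_of_eq (NNReal.eq (by simp; rfl))) (zero_le))
  have h := HasSubgaussianMGF.sum_of_iIndepFun hind (s := Finset.univ) fun i _ => h1 i
  refine hasSubgaussianMGF_mono (h.congr (.of_forall fun ω => ?_)) (le_of_eq ?_)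
  · simp [PiLp.inner_apply]
  · rw [← Finset.sum_mul]
    congr 1
    ext
    push_cast
    rw [EuclideanSpace.norm_sq_eq]

theorem IsGaussianNoise.measureReal_inner_gt_le {Ω : Type*} [MeasurableSpace Ω] {P : Measure Ω}
    [IsProbabilityMeasure P] {σ : ℝ≥0} {z : Ω → EuclideanSpace ℝ (Fin m)}
    (hz : IsGaussianNoise P σ z) {a : EuclideanSpace ℝ (Fin m)} {b : ℝ≥0} (hb : 0 < b)
    (ha : ‖a‖ ^ 2 ≤ b) {t : ℝ} (ht : 0 ≤ t) :
    P.real {ω | t * σ < inner ℝ (z ω) a} ≤ Real.exp (-t ^ 2 / (2 * b)) := by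
  have h := hasSubgaussianMGF_mono (hz.hasSubgaussianMGF_inner a)
    (show ‖a‖₊ ^ 2 * σ ^ 2 ≤ b * σ ^ 2 from
      mul_le_mul_of_nonneg_right (by exact_mod_cast ha) (zero_le))
  -- Without noise the Chernoff exponent degenerates, but the inner product vanishes almost surely
  -- and the strict inequality makes the event null.
  rcases eq_or_ne σ 0 with rfl | hσ
  · have h0 : P {ω | t * ((0 : ℝ≥0) : ℝ) < inner ℝ (z ω) a} = 0 := by
      rw [zero_pow two_ne_zero, mul_zero] at h
      refine measure_mono_null ?_ (ae_iff.1 h.ae_eq_zero_of_hasSubgaussianMGF_zero)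
      intro ω hω hω'
      simp [hω'] at hω
    rw [measureReal_def, h0]
    simpa using (Real.exp_pos _).le
  · have h1 := h.measure_ge_le (ε := t * σ) (by positivity)
    have hsub : {ω | t * σ < inner ℝ (z ω) a} ⊆ {ω | t * σ ≤ inner ℝ (z ω) a} :=
      Set.ofPred_subset_ofPred.2 fun ω hω => le_of_lt hω
    refine (measureReal_mono hsub).trans (h1.trans (le_of_eq ?_))
    congr 1
    have hσ' : (σ : ℝ) ≠ 0 := by exact_mod_cast hσ
    push_cast
    field_simp

/-- The per-dimension factor of the union bound: `81 ≤ e⁵` and `4√2 ≥ 5.6`. -/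
theorem nine_sq_mul_exp_le : (9 : ℝ) ^ 2 * Real.exp (-(4 * √2)) ≤ Real.exp (-(1 / 2)) := by
  have h1 : (81 : ℝ) ≤ Real.exp 5 := by
    have h := pow_le_pow_left₀ (by norm_num) Real.exp_one_gt_d9.le 5
    rw [← Real.exp_nat_mul] at h
    norm_num at h ⊢
    linarith
  have h2 : (1.4 : ℝ) ≤ √2 := Real.le_sqrt_of_sq_le (by norm_num)
  calc (9 : ℝ) ^ 2 * Real.exp (-(4 * √2)) ≤ Real.exp 5 * Real.exp (-(4 * √2)) := by
        gcongr
        linarith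
    _ = Real.exp (5 + -(4 * √2)) := (Real.exp_add _ _).symm
    _ ≤ Real.exp (-(1 / 2)) := Real.exp_le_exp.2 (by linarith)

/-- With overwhelming probability the noise is small in the operator norm after applying `A*`. -/
theorem IsGaussianNoise.exists_event {Ω : Type*} [MeasurableSpace Ω] {P : Measure Ω}
    [IsProbabilityMeasure P] {σ : ℝ≥0} {z : Ω → EuclideanSpace ℝ (Fin m)}
    (hz : IsGaussianNoise P σ z)
    {A : Matrix (Fin n₁) (Fin n₂) ℝ →ₗ[ℝ] EuclideanSpace ℝ (Fin m)} {k : ℕ} (hk : 1 ≤ k)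
    (h₁ : 1 ≤ n₁) (h₂ : 1 ≤ n₂) (hδ : isometryConst A k ≤ √2 - 1) :
    ∃ E : Set Ω, MeasurableSet E ∧
      1 - 2 * Real.exp (-(1 / 2) * (max n₁ n₂ : ℕ)) ≤ P.real E ∧
      ∀ ω ∈ E, opNorm (adj A (z ω)) ≤ 8 * √(max n₁ n₂ : ℕ) * σ := by
  obtain ⟨S, hSc, hS1, hS⟩ := exists_net_unit (EuclideanSpace ℝ (Fin n₁))
  obtain ⟨T, hTc, hT1, hT⟩ := exists_net_unit (EuclideanSpace ℝ (Fin n₂))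
  rw [finrank_euclideanSpace_fin] at hSc hTc
  set n := max n₁ n₂ with hn
  set a : EuclideanSpace ℝ (Fin n₁) × EuclideanSpace ℝ (Fin n₂) → EuclideanSpace ℝ (Fin m) :=
    fun p => A (vecMulVec p.1.ofLp p.2.ofLp) with ha
  -- The threshold is half the target `8√n σ`, as the net argument doubles it. With variance proxy
  -- at most `√2 σ²`, each tail is at most `exp(-16n/(2√2)) = exp(-4√2 n)`.
  set B : Set Ω := ⋃ p ∈ S ×ˢ T, {ω | 4 * √n * σ < inner ℝ (z ω) (a p)} with hB
  have hnorm : ∀ p ∈ S ×ˢ T, ‖a p‖ ^ 2 ≤ √2 := by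
    intro p hp
    obtain ⟨hp1, hp2⟩ := Finset.mem_product.1 hp
    have h := ((isLeast_isometryConst A hk h₁ h₂).1 (vecMulVec p.1.ofLp p.2.ofLp)
      ((rank_vecMulVec_le _ _).trans hk)).2
    rw [frobNorm_vecMulVec_sq, hS1 _ hp1, hT1 _ hp2] at h
    simp only [ha]
    linarith
  have hPB : P.real B ≤ Real.exp (-(1 / 2) * n) := by
    have hcard : ((S ×ˢ T).card : ℝ) ≤ (9 ^ 2) ^ n := by
      rw [Finset.card_product, ← pow_mul, mul_comm 2, pow_mul, sq]
      exact_mod_cast Nat.mul_le_mul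
        (hSc.trans (Nat.pow_le_pow_right (by norm_num) (le_max_left _ _)))
        (hTc.trans (Nat.pow_le_pow_right (by norm_num) (le_max_right _ _)))
    have hone : ∀ p ∈ S ×ˢ T, P.real {ω | 4 * √n * σ < inner ℝ (z ω) (a p)} ≤
        Real.exp (-(4 * √2)) ^ n := by
      intro p hp
      have h2 : (0 : ℝ≥0) < NNReal.sqrt 2 := by simp
      refine (hz.measureReal_inner_gt_le h2 (a := a p)
        (by simpa using hnorm p hp) (by positivity)).trans (le_of_eq ?_)
      rw [← Real.exp_nat_mul]
      congr 1
      have h3 : √2 * √2 = (2 : ℝ) := Real.mul_self_sqrt zero_le_two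
      have h4 : √2 ≠ (0 : ℝ) := by positivity
      rw [mul_pow, Real.sq_sqrt (Nat.cast_nonneg _), Real.coe_sqrt, NNReal.coe_ofNat]
      field_simp
      linear_combination (2 * (n : ℝ)) * h3
    calc P.real B ≤ ∑ p ∈ S ×ˢ T, P.real {ω | 4 * √n * σ < inner ℝ (z ω) (a p)} :=
          measureReal_biUnion_finset_le _ _
      _ ≤ (S ×ˢ T).card • Real.exp (-(4 * √2)) ^ n := Finset.sum_le_card_nsmul _ _ _ hone
      _ ≤ (9 ^ 2) ^ n * Real.exp (-(4 * √2)) ^ n := by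
          rw [nsmul_eq_mul]
          exact mul_le_mul_of_nonneg_right hcard (by positivity)
      _ = (9 ^ 2 * Real.exp (-(4 * √2))) ^ n := (mul_pow _ _ _).symm
      _ ≤ Real.exp (-(1 / 2)) ^ n := pow_le_pow_left₀ (by positivity) nine_sq_mul_exp_le _
      _ = Real.exp (-(1 / 2) * n) := by rw [← Real.exp_nat_mul, mul_comm]
  -- The noise is only almost everywhere measurable, so `B` is replaced by a measurable hull of
  -- equal measure.
  refine ⟨(toMeasurable P B)ᶜ, (measurableSet_toMeasurable P B).compl, ?_, fun ω hω => ?_⟩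
  · rw [probReal_compl_eq_one_sub (measurableSet_toMeasurable P B), measureReal_def,
      measure_toMeasurable, ← measureReal_def]
    linarith [Real.exp_pos (-(1 / 2) * n)]
  · have hωB : ω ∉ B := fun h => hω (subset_toMeasurable P B h)
    have h := opNorm_le_two_mul_of_net (Y := adj A (z ω)) hS hS1 hT
      (c := 4 * √n * σ) (by positivity) fun u hu v hv => by
        rw [← frobInner_vecMulVec, frobInner_adj]
        by_contra! hcon
        exact hωB (Set.mem_iUnion₂.2 ⟨(u, v), Finset.mem_product.2 ⟨hu, hv⟩, hcon⟩)
    linarith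

end LowRank

end

/-! ### Choice of constants and conclusion. -/

theorem mainTheorem1 :
    ∃ (C₀ C₁ C' : ℝ → ℝ) (c : ℝ), 0 < c ∧
      ∀ (n₁ n₂ m r : ℕ), 1 ≤ r →
      ∀ (A : Matrix (Fin n₁) (Fin n₂) ℝ →ₗ[ℝ] EuclideanSpace ℝ (Fin m))
        (M : Matrix (Fin n₁) (Fin n₂) ℝ), M.rank ≤ r →
        -- the Dantzig selector with deterministic noise
        (LowRank.isometryConst A (4 * r) < √2 - 1 →
          ∀ (z : EuclideanSpace ℝ (Fin m)) (lam : ℝ),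
            LowRank.opNorm (LowRank.adj A z) ≤ lam →
            ∀ Mhat : Matrix (Fin n₁) (Fin n₂) ℝ,
              LowRank.IsDantzigSolution A (A M + z) lam Mhat →
              LowRank.frobNorm (Mhat - M) ^ 2 ≤
                C₀ (LowRank.isometryConst A (4 * r)) * r * lam ^ 2) ∧
        -- the Lasso with deterministic noise
        (LowRank.isometryConst A (4 * r) < (3 * √2 - 1) / 17 →
          ∀ (z : EuclideanSpace ℝ (Fin m)) (μ : ℝ), 0 < μ →
            LowRank.opNorm (LowRank.adj A z) ≤ μ / 2 →
            ∀ Mhat : Matrix (Fin n₁) (Fin n₂) ℝ,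
              LowRank.IsLassoSolution A (A M + z) μ Mhat →
              LowRank.frobNorm (Mhat - M) ^ 2 ≤
                C₁ (LowRank.isometryConst A (4 * r)) * r * μ ^ 2) ∧
        -- Gaussian noise
        (∀ (Ω : Type*) [MeasurableSpace Ω] (P : Measure Ω) [IsProbabilityMeasure P] (σ : ℝ≥0)
          (z : Ω → EuclideanSpace ℝ (Fin m)), LowRank.IsGaussianNoise P σ z →
          (LowRank.isometryConst A (4 * r) < √2 - 1 →
            ∃ E : Set Ω, MeasurableSet E ∧
              1 - 2 * Real.exp (-c * (max n₁ n₂ : ℕ)) ≤ P.real E ∧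
              ∀ ω ∈ E, ∀ Mhat : Matrix (Fin n₁) (Fin n₂) ℝ,
                LowRank.IsDantzigSolution A (A M + z ω) (8 * √(max n₁ n₂ : ℕ) * σ) Mhat →
                LowRank.frobNorm (Mhat - M) ^ 2 ≤
                  C' (LowRank.isometryConst A (4 * r)) * (max n₁ n₂ : ℕ) * r * (σ : ℝ) ^ 2) ∧
          (LowRank.isometryConst A (4 * r) < (3 * √2 - 1) / 17 → 0 < σ →
            ∃ E : Set Ω, MeasurableSet E ∧
              1 - 2 * Real.exp (-c * (max n₁ n₂ : ℕ)) ≤ P.real E ∧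
              ∀ ω ∈ E, ∀ Mhat : Matrix (Fin n₁) (Fin n₂) ℝ,
                LowRank.IsLassoSolution A (A M + z ω) (16 * √(max n₁ n₂ : ℕ) * σ) Mhat →
                LowRank.frobNorm (Mhat - M) ^ 2 ≤
                  C' (LowRank.isometryConst A (4 * r)) * (max n₁ n₂ : ℕ) * r * (σ : ℝ) ^ 2)) := by
  set D : ℝ → ℝ := fun δ => (4 / (1 - (1 + √2) * δ)) ^ 2 * 4 with hD
  set L : ℝ → ℝ := fun δ => (12 / (1 - (1 + 3 * √2) * δ)) ^ 2 with hL
  have hD0 : ∀ δ, 0 ≤ D δ := fun δ => by positivity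
  have hL0 : ∀ δ, 0 ≤ L δ := fun δ => by positivity
  -- The factors are `8²` and `16²`, from `λ` and `μ`; the sum serves both estimators.
  refine ⟨D, L, fun δ => 64 * D δ + 256 * L δ, 1 / 2, by norm_num, ?_⟩
  intro n₁ n₂ m r hr A M hM
  refine ⟨fun hδ z lam hz X hX => LowRank.dantzig_error_le hr hM hδ hz hX,
    fun hδ z μ hμ hz X hX => LowRank.lasso_error_le hr hM hδ hμ hz hX, ?_⟩
  intro Ω _ P _ σ z hz
  set δ := LowRank.isometryConst A (4 * r) with hδdef
  have hr4 : 1 ≤ 4 * r := by omega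
  have hDδ := hD0 δ
  have hLδ := hL0 δ
  by_cases hn : n₁ = 0 ∨ n₂ = 0
  · have htriv : ∃ E : Set Ω, MeasurableSet E ∧
        1 - 2 * Real.exp (-(1 / 2) * (max n₁ n₂ : ℕ)) ≤ P.real E ∧
        ∀ ω ∈ E, ∀ X : Matrix (Fin n₁) (Fin n₂) ℝ, LowRank.frobNorm (X - M) ^ 2 ≤
          (64 * D δ + 256 * L δ) * (max n₁ n₂ : ℕ) * r * (σ : ℝ) ^ 2 := by
      refine ⟨Set.univ, .univ, ?_, fun ω _ X => ?_⟩
      · rw [probReal_univ]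
        linarith [Real.exp_pos (-(1 / 2) * (max n₁ n₂ : ℕ))]
      · rw [LowRank.frobNorm_eq_zero_of_isEmpty hn, zero_pow two_ne_zero]
        positivity
    obtain ⟨E, hE, hP, h⟩ := htriv
    exact ⟨fun _ => ⟨E, hE, hP, fun ω hω X _ => h ω hω X⟩,
      fun _ _ => ⟨E, hE, hP, fun ω hω X _ => h ω hω X⟩⟩
  push Not at hn
  have h₁ := Nat.one_le_iff_ne_zero.2 hn.1
  have h₂ := Nat.one_le_iff_ne_zero.2 hn.2
  have hn0 : (0 : ℝ) < (max n₁ n₂ : ℕ) := by exact_mod_cast h₁.trans (le_max_left _ _)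
  have hsq : √((max n₁ n₂ : ℕ) : ℝ) ^ 2 = (max n₁ n₂ : ℕ) := Real.sq_sqrt hn0.le
  set n : ℝ := ((max n₁ n₂ : ℕ) : ℝ) with hndef
  refine ⟨fun hδ => ?_, fun hδ hσ => ?_⟩
  · obtain ⟨E, hE, hP, h⟩ := hz.exists_event hr4 h₁ h₂ hδ.le
    refine ⟨E, hE, hP, fun ω hω X hX => ?_⟩
    refine (LowRank.dantzig_error_le hr hM hδ (h ω hω) hX).trans ?_
    calc D δ * r * (8 * √n * σ) ^ 2 = 64 * D δ * n * r * (σ : ℝ) ^ 2 := by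
          rw [mul_pow, mul_pow, hsq]
          ring
      _ ≤ _ := by
          gcongr
          linarith
  -- The Lasso threshold is the smaller one, so the same noise event applies, with `8√n σ = μ/2`.
  · have hδ' : δ ≤ √2 - 1 := by
      have : (1.4 : ℝ) ≤ √2 := Real.le_sqrt_of_sq_le (by norm_num)
      linarith
    obtain ⟨E, hE, hP, h⟩ := hz.exists_event hr4 h₁ h₂ hδ'
    refine ⟨E, hE, hP, fun ω hω X hX => ?_⟩
    have hσ' : (0 : ℝ) < σ := hσ
    refine (LowRank.lasso_error_le hr hM hδ (by positivity)
      ((h ω hω).trans (le_of_eq (by ring))) hX).trans ?_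
    calc L δ * r * (16 * √n * σ) ^ 2 = 256 * L δ * n * r * (σ : ℝ) ^ 2 := by
          rw [mul_pow, mul_pow, hsq]
          ring
      _ ≤ _ := by
          gcongr
          linarith
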